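/- For an $n$-qubit pure state $|\psi\rangle$ (a unit vector of $(\mathbb C^2)^{\otimes n}$) put $\pi(x)=|\langle x|\psi\rangle|^2$, $x\in\{0,1\}^n$. Let $\tau(\psi)=1/(1-\lambda_1)$ be the relaxation time (with $\tau(\psi)=\infty$ if $\lambda_1=1$), where $\lambda_1$ is the second largest eigenvalue, counted with multiplicity, of the random walk on the support of $\pi$ with $P(x,y)=\frac1n\frac{\pi(y)}{\pi(x)+\pi(y)}$ if $x,y$ differ in exactly one bit (written $x\sim y$), $P(x,x)=\frac1n\sum_{x'\sim x}\frac{\pi(x)}{\pi(x)+\pi(x')}$, and $P(x,y)=0$ otherwise. Consider the following certification procedure, with parameters $\epsilon>0$, $\tau^*>0$ and $T\in\mathbb N$, for an unknown (possibly mixed) $n$-qubit state $\rho$ and the target $|\psi\rangle$. On each of $T$ independent copies of $\rho$: choose a qubit $k$ uniformly at random; measure every other qubit in the computational basis, with outcomes $z\in\{0,1\}^{n-1}$; measure qubit $k$ in the orthonormal basis formed by $|\Psi_{k,z}\rangle=\dfrac{\psi(z^{(0)})|0\rangle+\psi(z^{(1)})|1\rangle}{\sqrt{|\psi(z^{(0)})|^2+|\psi(z^{(1)})|^2}}$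 and its orthogonal complement, where $\psi(x)=\langle x|\psi\rangle$ and $z^{(a)}$ is $z$ with the bit $a$ inserted at position $k$; report $\omega=1$ on the outcome $|\Psi_{k,z}\rangle$ and $\omega=0$ otherwise (also $\omega=0$ if $\psi(z^{(0)})=\psi(z^{(1)})=0$). Output \textsc{Certified} if the mean $\hat\omega$ of the $T$ values satisfies $\hat\omega\ge 1-\frac{3\epsilon}{4\tau^*}$, and \textsc{Failed} otherwise. Only single-qubit measurements are used. Theorem. There are universal constants $c,A,B>0$ and $n_0\in\mathbb N$ such that for every $n\ge n_0$, with $\tau^*=A n^2$, all $n$-qubit pure states $|\psi\rangle$ except for a set of Haar measure at most $2^{-cn}$ have the following two properties. (1) $\tau(\psi)\le\tau^*$. (2) For all $\epsilon>0$, all $\delta\in(0,1)$, every number of copies $T\ge B\,\frac{n^2}{\epsilon}\log\frac1\delta$ and every $n$-qubit state $\rho$, the procedure outputs \textsc{Failed} with probability at least $1-\delta$ if $\langle\psi|\rho|\psi\rangle<1-\epsilon$, and outputs \textsc{Certified} with probability at least $1-\delta$ if $\langle\psi|\rho|\psi\rangle\ge 1-\frac{\epsilon}{2\tau^*}$. 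-/

import Mathlib

open scoped ENNReal ComplexOrder

namespace ShadowOverlap

/-- The vertices of the Boolean hypercube `{0,1}ⁿ` (`false` is `0`, `true` is `1`). -/
abbrev Cube (n : ℕ) : Type := Fin n → Bool

/-- The `n`-qubit Hilbert space `(ℂ²)^{⊗n}`, in the computational basis. -/
abbrev QubitSpace (n : ℕ) : Type := EuclideanSpace ℂ (Cube n)

/-- The `n`-qubit pure states: unit vectors. -/
abbrev PureState (n : ℕ) : Type := Metric.sphere (0 : QubitSpace n) 1

/-- The Haar (uniform) probability measure on `n`-qubit pure states: the normalized surface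
measure of the unit sphere. -/
noncomputable def haarState (n : ℕ) : MeasureTheory.Measure (PureState n) :=
  ((MeasureTheory.volume : MeasureTheory.Measure (QubitSpace n)).toSphere Set.univ)⁻¹ •
    (MeasureTheory.volume : MeasureTheory.Measure (QubitSpace n)).toSphere

/-! ### The Markov chain and its relaxation time -/

/-- The computational-basis measurement distribution `π(x) = |⟨x|ψ⟩|²`. -/
noncomputable def measDist {n : ℕ} (ψ : PureState n) (x : Cube n) : ℝ := ‖ψ.1 x‖ ^ 2

/-- The transition matrix of the random walk attached to the weights `π`, on the support of `π`:
`P(x,y) = (1/n) π(y)/(π(x)+π(y))` when `x, y` differ in exactly one bit,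
`P(x,x) = (1/n) ∑_{x' ∼ x} π(x)/(π(x)+π(x'))`, and `P(x,y) = 0` otherwise. -/
noncomputable def transition {n : ℕ} (w : Cube n → ℝ) :
    Matrix {x : Cube n // 0 < w x} {x : Cube n // 0 < w x} ℝ :=
  fun x y =>
    if hammingDist x.1 y.1 = 1 then (1 / n) * (w y.1 / (w x.1 + w y.1))
    else if x = y then
      (1 / n) * ∑ x' : Cube n, if hammingDist x.1 x' = 1 then w x.1 / (w x.1 + w x') else 0
    else 0

/-- The second largest eigenvalue, counted with multiplicity, of a reversible transition matrix.
Such a matrix is diagonalizable with real eigenvalues, its largest eigenvalue is `1`, and the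
constant functions are eigenfunctions for it; so the second largest eigenvalue is the largest one
that has a nonconstant eigenfunction (and it equals `1` if the eigenvalue `1` is degenerate). -/
noncomputable def secondEigenvalue {ι : Type} [Fintype ι] (P : Matrix ι ι ℝ) : ℝ :=
  sSup {l : ℝ | ∃ f : ι → ℝ, (¬ ∃ a : ℝ, ∀ x, f x = a) ∧ P.mulVec f = l • f}

/-- The relaxation time `τ = 1 / (1 - λ₁)` of the walk attached to `ψ`, with value `∞` when the
spectral gap `1 - λ₁` vanishes. -/
noncomputable def relaxationTime {n : ℕ} (ψ : PureState n) : ℝ≥0∞ :=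
  (ENNReal.ofReal (1 - secondEigenvalue (transition (measDist ψ))))⁻¹

/-! ### Density matrices and fidelity -/

/-- An `n`-qubit (possibly mixed) state. -/
def IsDensityMatrix {n : ℕ} (ρ : Matrix (Cube n) (Cube n) ℂ) : Prop :=
  ρ.PosSemidef ∧ ρ.trace = 1

/-- The quadratic form `⟨v|ρ|v⟩`, a nonnegative real number when `ρ` is positive semidefinite. -/
noncomputable def expectation {n : ℕ} (ρ : Matrix (Cube n) (Cube n) ℂ) (v : Cube n → ℂ) : ℝ :=
  (dotProduct (star v) (ρ.mulVec v)).re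

/-- The fidelity `⟨ψ|ρ|ψ⟩`. -/
noncomputable def fidelity {n : ℕ} (ψ : PureState n) (ρ : Matrix (Cube n) (Cube n) ℂ) : ℝ :=
  expectation ρ (fun x => ψ.1 x)

/-! ### The certification protocol

One round acts on one fresh copy of `ρ`: a uniformly random qubit `k` is selected; every other
qubit is measured in the computational basis, with outcomes `z`; then qubit `k` is measured in
the orthonormal basis consisting of `|Ψ_{k,z}⟩ ∝ Ψ(z⁽⁰⁾)|0⟩ + Ψ(z⁽¹⁾)|1⟩` and its orthogonal
complement.  The round reports `ω = 1` on the outcome `Ψ_{k,z}` and `ω = 0` otherwise.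

The record of a round is a pair `(k, x)`: for `i ≠ k` the bit `x i` is the outcome `z i` of qubit
`i`, and `x k` tells whether the outcome on qubit `k` was `Ψ_{k,z}` (`true`) or its orthogonal
complement (`false`). -/

/-- The amplitude `Ψ(z⁽ᵃ⁾)`, where `z⁽ᵃ⁾` agrees with `x` off the `k`-th bit and has `k`-th bit `a`.
It does not depend on `x k`. -/
def queryAmp {n : ℕ} (Ψ : Cube n → ℂ) (k : Fin n) (x : Cube n) (a : Bool) : ℂ :=
  Ψ (Function.update x k a)

/-- Both queried amplitudes vanish, so that `Ψ_{k,z}` is undefined. -/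
def Degenerate {n : ℕ} (Ψ : Cube n → ℂ) (k : Fin n) (x : Cube n) : Prop :=
  queryAmp Ψ k x false = 0 ∧ queryAmp Ψ k x true = 0

/-- The normalization `√(|Ψ(z⁽⁰⁾)|² + |Ψ(z⁽¹⁾)|²)`. -/
noncomputable def queryNorm {n : ℕ} (Ψ : Cube n → ℂ) (k : Fin n) (x : Cube n) : ℝ :=
  Real.sqrt (‖queryAmp Ψ k x false‖ ^ 2 + ‖queryAmp Ψ k x true‖ ^ 2)

open Classical in
/-- The orthonormal basis of `ℂ²` in which qubit `k` is measured: `Ψ_{k,z}` for `true`, its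
orthogonal complement for `false`; in the degenerate case the computational basis is used. -/
noncomputable def qubitBasis {n : ℕ} (Ψ : Cube n → ℂ) (k : Fin n) (x : Cube n) (b : Bool) :
    Bool → ℂ :=
  if Degenerate Ψ k x then Pi.single b 1
  else fun a => match b, a with
    | true, a => queryAmp Ψ k x a / (queryNorm Ψ k x : ℂ)
    | false, false => - star (queryAmp Ψ k x true) / (queryNorm Ψ k x : ℂ)
    | false, true => star (queryAmp Ψ k x false) / (queryNorm Ψ k x : ℂ)

/-- The product vector `⨂ᵢ |vᵢ⟩` belonging to the record `(k, x)`: the `i`-th factor is `|x i⟩` for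
`i ≠ k`, and the `k`-th factor is the basis vector numbered `x k` of the basis of qubit `k`. -/
noncomputable def outcomeVec {n : ℕ} (Ψ : Cube n → ℂ) (k : Fin n) (x : Cube n) : Cube n → ℂ :=
  fun y => ∏ i : Fin n,
    if i = k then qubitBasis Ψ k x (x k) (y i) else (Pi.single (x i) 1 : Bool → ℂ) (y i)

/-- The probability (Born rule) that a round on the state `ρ` has the record `o = (k, x)`. -/
noncomputable def roundProb {n : ℕ} (Ψ : Cube n → ℂ) (ρ : Matrix (Cube n) (Cube n) ℂ)
    (o : Fin n × Cube n) : ℝ :=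
  (1 / n) * expectation ρ (outcomeVec Ψ o.1 o.2)

open Classical in
/-- The local overlap `ω ∈ {0, 1}` reported in a round; it is `0` in the degenerate case. -/
noncomputable def localOverlap {n : ℕ} (Ψ : Cube n → ℂ) (o : Fin n × Cube n) : ℝ :=
  if Degenerate Ψ o.1 o.2 then 0 else if o.2 o.1 = true then 1 else 0

/-- The two possible outputs of the procedure. -/
inductive Verdict : Type
  | certified
  | failed

open Classical in
/-- The output on the records of `T` rounds: `certified` if the empirical mean of the local
overlaps is at least `1 - 3ε/(4τ)`, and `failed` otherwise. -/
noncomputable def verdict {n T : ℕ} (Ψ : Cube n → ℂ) (ε τ : ℝ) (o : Fin T → Fin n × Cube n) :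
    Verdict :=
  if 1 - 3 * ε / (4 * τ) ≤ (∑ t, localOverlap Ψ (o t)) / T then Verdict.certified
  else Verdict.failed

open Classical in
/-- The probability that the procedure, run with the amplitudes `Ψ` and the parameters `ε` and `τ`
on `T` independent copies of `ρ`, outputs `v`. -/
noncomputable def outputProb {n : ℕ} (Ψ : Cube n → ℂ) (ρ : Matrix (Cube n) (Cube n) ℂ)
    (ε τ : ℝ) (T : ℕ) (v : Verdict) : ℝ :=
  ∑ o : Fin T → Fin n × Cube n,
    if verdict Ψ ε τ o = v then ∏ t, roundProb Ψ ρ (o t) else 0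

/-- On the target `ψ`, the procedure with parameters `ε` and `τ` run on `T` copies decides with
error probability at most `δ`, whatever the unknown state `ρ` is. -/
def CertifiesTarget {n : ℕ} (ψ : PureState n) (ε τ δ : ℝ) (T : ℕ) : Prop :=
  ∀ ρ : Matrix (Cube n) (Cube n) ℂ, IsDensityMatrix ρ →
    (fidelity ψ ρ < 1 - ε →
      1 - δ ≤ outputProb (fun x => ψ.1 x) ρ ε τ T Verdict.failed) ∧
    (1 - ε / (2 * τ) ≤ fidelity ψ ρ →
      1 - δ ≤ outputProb (fun x => ψ.1 x) ρ ε τ T Verdict.certified)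

end ShadowOverlap

namespace ShadowOverlap

open MeasureTheory

/-! ### Gaussian integrals over the sphere -/

/-! Everything follows from one Poincaré inequality `Var_π(f) ≤ K · E(f)`, where `E` is the
Dirichlet form of the walk and `K` is of order `n²`.

Its link with the protocol is exact. Write `ρ = Bᴴ B` and, for a row `b` of `B`, let `g = b / conj
ψ`. When `π > 0` everywhere, the event `ω = 0` in a round has probability `E(Re g) + E(Im g)` summed
over the rows, while `1 - ⟨ψ|ρ|ψ⟩` is the sum of the variances of `Re g` and `Im g` under `π`. Since
`E ≤ Var ≤ K E`, the rejection probability `q` of a round satisfies `(1 - F)/K ≤ q ≤ 1 - F`, with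
`F` the fidelity (`roundError_bounds`). The two cases to be told apart become `q ≥ ε/K` and `q ≤
ε/(2K)`, and a multiplicative Chernoff bound (`sum_prod_tail_le`) separates them with `O(K/ε ·
log(1/δ))` copies. The same inequality bounds the relaxation time by `K` (`relaxationTime_le`).

For a Haar random `ψ`, with overwhelming probability all weights are positive and `O(n 2⁻ⁿ)`, and at
every vertex seven eighths of the neighbours have weight at least a constant times `2⁻ⁿ`
(`haarState_not_typical_le`). These estimates come from an exponential Markov inequality for
quadratic forms of Gaussian vectors (`haarState_quadratic_nonpos_le`).

Such weights satisfy the Poincaré inequality (`exists_weighted_poincare`): `f` is replaced by its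
average `F` over good neighbours, the inequality of the uniform cube is applied to `F`, and `f - F`
and the gradient of `F` are controlled by short detours through good vertices. The ratio of the
upper to the lower weight costs one factor `n`, and the `1/n` in the transition probabilities the
other. -/

theorem exists_lintegral_exp_neg_quadratic (n : ℕ) :
    ∃ C : ℝ≥0∞, C ≠ 0 ∧ C ≠ ∞ ∧ ∀ b : Cube n → ℝ, (∀ x, 0 < b x) →
      ∫⁻ v : QubitSpace n, ENNReal.ofReal (Real.exp (-∑ x, b x * ‖v x‖ ^ 2)) =
        C * ENNReal.ofReal (∏ x, (b x)⁻¹) := by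
  let e : (Cube n → ℂ) ≃L[ℝ] QubitSpace n :=
    (PiLp.continuousLinearEquiv 2 ℝ (fun _ : Cube n => ℂ)).symm
  have hm : Measure.IsAddHaarMeasure ((volume : Measure (Cube n → ℂ)).map e) :=
    e.isAddHaarMeasure_map _
  -- Uniqueness of Haar measure suffices: only ratios of these integrals are used, so the value of
  -- `c` is irrelevant.
  obtain ⟨c, hc0, hct, hc⟩ : ∃ c : ℝ≥0∞, c ≠ 0 ∧ c ≠ ∞ ∧
      (volume : Measure (QubitSpace n)) = c • (volume : Measure (Cube n → ℂ)).map e := by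
    refine ⟨Measure.addHaarScalarFactor volume ((volume : Measure (Cube n → ℂ)).map e), ?_,
      ENNReal.coe_ne_top, Measure.isAddLeftInvariant_eq_smul _ _⟩
    simpa using (Measure.addHaarScalarFactor_pos_of_isAddHaarMeasure volume
      ((volume : Measure (Cube n → ℂ)).map e)).ne'
  refine ⟨c * ENNReal.ofReal (∏ _x : Cube n, Real.pi), mul_ne_zero hc0 ?_,
    ENNReal.mul_ne_top hct ENNReal.ofReal_ne_top, fun b hb => ?_⟩
  · simp only [ne_eq, ENNReal.ofReal_eq_zero, not_le]
    exact Finset.prod_pos fun _ _ => Real.pi_pos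
  have h1 : ∀ x, ∫ z : ℂ, Real.exp (-b x * ‖z‖ ^ 2) = Real.pi * (b x)⁻¹ := fun x => by
    rw [GaussianFourier.integral_rexp_neg_mul_sq_norm (hb x), Complex.finrank_real_complex]
    norm_num [div_eq_mul_inv]
  have hi : ∀ x, Integrable fun z : ℂ => Real.exp (-b x * ‖z‖ ^ 2) := fun x =>
    Integrable.of_integral_ne_zero <| by
      rw [h1]; exact (mul_pos Real.pi_pos (inv_pos.2 (hb x))).ne'
  have hexp : ∀ v : Cube n → ℂ, Real.exp (-∑ x, b x * ‖v x‖ ^ 2) =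
      ∏ x, Real.exp (-b x * ‖v x‖ ^ 2) := fun v => by
    rw [← Real.exp_sum]; simp [Finset.sum_neg_distrib]
  rw [hc, lintegral_smul_measure, smul_eq_mul,
    lintegral_map (by fun_prop) e.continuous.measurable, mul_assoc]
  congr 1
  have h2 : ∀ v : Cube n → ℂ, ∀ x, (e v) x = v x := fun _ _ => rfl
  change ∫⁻ v : Cube n → ℂ, ENNReal.ofReal (Real.exp (-∑ x, b x * ‖(e v) x‖ ^ 2)) = _
  simp_rw [h2, hexp]
  rw [volume_pi, ← ofReal_integral_eq_lintegral_ofReal (Integrable.fintype_prod hi)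
    (Filter.Eventually.of_forall fun v => Finset.prod_nonneg fun _ _ => (Real.exp_pos _).le)]
  rw [← volume_pi, integral_fintype_prod_volume_eq_prod (fun x (z : ℂ) => Real.exp (-b x * ‖z‖ ^ 2))]
  simp_rw [h1]
  rw [Finset.prod_mul_distrib, ENNReal.ofReal_mul (Finset.prod_nonneg fun _ _ => Real.pi_pos.le)]

/-- Polar coordinates: the Gaussian mass of the cone over `S` factors, and the radial factor `R` is
the same for every `S`. -/
theorem exists_lintegral_sphere_indicator (n : ℕ) : ∃ R : ℝ≥0∞, ∀ S : Set (PureState n),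
    MeasurableSet S →
      ∫⁻ v : ({0}ᶜ : Set (QubitSpace n)),
        S.indicator 1 (homeomorphUnitSphereProd _ v).1 * ENNReal.ofReal (Real.exp (-‖v.1‖ ^ 2))
        ∂(Measure.comap Subtype.val volume) =
      (volume : Measure (QubitSpace n)).toSphere S * R := by
  refine ⟨∫⁻ r : Set.Ioi (0 : ℝ), ENNReal.ofReal (Real.exp (-r.1 ^ 2))
    ∂(Measure.volumeIoiPow (Module.finrank ℝ (QubitSpace n) - 1)), fun S hS => ?_⟩
  have h := (Measure.measurePreserving_homeomorphUnitSphereProd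
    (volume : Measure (QubitSpace n))).lintegral_comp
    (f := fun p => S.indicator 1 p.1 * ENNReal.ofReal (Real.exp (-p.2.1 ^ 2))) (by
      refine ((measurable_one.indicator hS).comp measurable_fst).mul ?_
      fun_prop)
  simp only [homeomorphUnitSphereProd_apply_snd_coe] at h
  rw [h, ← lintegral_indicator_one hS]
  exact lintegral_prod_mul (f := S.indicator 1)
    (g := fun r : Set.Ioi (0 : ℝ) => ENNReal.ofReal (Real.exp (-r.1 ^ 2)))
    (measurable_one.indicator hS).aemeasurable (by fun_prop)

/-- Exponential Markov inequality. The condition is homogeneous, so the Haar measure of the set is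
the normalized Gaussian mass of its cone. On that cone `exp (-‖v‖²)` is at most `exp (-∑ (1 + a x)
‖v x‖²)`, whose integral over the whole space is a product. -/
theorem haarState_quadratic_nonpos_le {n : ℕ} (a : Cube n → ℝ) (ha : ∀ x, -1 < a x) :
    haarState n {ψ | ∑ x, a x * ‖ψ.1 x‖ ^ 2 ≤ 0} ≤ ENNReal.ofReal (∏ x, (1 + a x)⁻¹) := by
  obtain ⟨C, hC0, hCt, hC⟩ := exists_lintegral_exp_neg_quadratic n
  obtain ⟨R, hR⟩ := exists_lintegral_sphere_indicator n
  set S : Set (PureState n) := {ψ | ∑ x, a x * ‖ψ.1 x‖ ^ 2 ≤ 0} with hSdef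
  have hS : MeasurableSet S := by
    apply IsClosed.measurableSet
    apply isClosed_le _ continuous_const
    fun_prop
  have hcompl : ∀ f : QubitSpace n → ℝ≥0∞,
      ∫⁻ v : ({0}ᶜ : Set (QubitSpace n)), f v.1 ∂(Measure.comap Subtype.val volume) =
        ∫⁻ v, f v := fun f => by
    rw [lintegral_subtype_comap (measurableSet_singleton _).compl, restrict_compl_singleton]
  -- Taking all coefficients equal to `1` relates the constants, which then cancel after
  -- normalization.
  have hZ : (volume : Measure (QubitSpace n)).toSphere Set.univ * R = C := by
    have h := hC (fun _ => 1) (fun _ => one_pos)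
    simp only [one_mul, inv_one, Finset.prod_const_one, ENNReal.ofReal_one, mul_one] at h
    rw [← h, ← hR _ MeasurableSet.univ, ← hcompl]
    refine lintegral_congr fun v => ?_
    simp [EuclideanSpace.norm_sq_eq]
  have hle : (volume : Measure (QubitSpace n)).toSphere S * R ≤
      C * ENNReal.ofReal (∏ x, (1 + a x)⁻¹) := by
    rw [← hC _ (fun x => by linarith [ha x]), ← hR _ hS, ← hcompl]
    refine lintegral_mono fun v => ?_
    by_cases hv : (homeomorphUnitSphereProd (QubitSpace n) v).1 ∈ S
    · simp only [Set.indicator_of_mem hv, Pi.one_apply, one_mul]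
      refine ENNReal.ofReal_le_ofReal (Real.exp_le_exp.2 (neg_le_neg ?_))
      rw [EuclideanSpace.norm_sq_eq]
      have hpos : 0 < ‖v.1‖ := norm_pos_iff.2 v.2
      have h1 : ∑ x, a x * ‖v.1 x‖ ^ 2 ≤ 0 := by
        have h2 : ∑ x, a x * ‖v.1 x‖ ^ 2 = ‖v.1‖ ^ 2 *
            ∑ x, a x * ‖(homeomorphUnitSphereProd (QubitSpace n) v).1.1 x‖ ^ 2 := by
          rw [Finset.mul_sum]
          refine Finset.sum_congr rfl fun x _ => ?_
          simp only [homeomorphUnitSphereProd_apply_fst_coe, PiLp.smul_apply, norm_smul, norm_inv,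
            norm_norm]
          field_simp
        rw [h2]
        exact mul_nonpos_of_nonneg_of_nonpos (sq_nonneg _) hv
      simp only [add_mul, one_mul, Finset.sum_add_distrib]
      linarith
    · simp [Set.indicator_of_notMem hv]
  have hR0 : R ≠ 0 := fun h => hC0 (by rw [← hZ, h, mul_zero])
  have hu0 : (volume : Measure (QubitSpace n)).toSphere Set.univ ≠ 0 :=
    fun h => hC0 (by rw [← hZ, h, zero_mul])
  have hut : (volume : Measure (QubitSpace n)).toSphere Set.univ ≠ ∞ := measure_ne_top _ _
  have hRt : R ≠ ∞ := fun h => hCt (by rw [← hZ, h, ENNReal.mul_top hu0])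
  rw [haarState, Measure.smul_apply, smul_eq_mul, ENNReal.inv_mul_le_iff hu0 hut]
  rw [← hZ] at hle
  rw [mul_right_comm] at hle
  exact (ENNReal.mul_le_mul_iff_left hR0 hRt).1 hle

end ShadowOverlap

namespace ShadowOverlap

/-! ### The hypercube and its Poincaré inequality -/

/-- The neighbour of `x` in direction `i`. -/
def flipBit {n : ℕ} (x : Cube n) (i : Fin n) : Cube n := Function.update x i (!x i)

@[simp]
theorem flipBit_flipBit {n : ℕ} (x : Cube n) (i : Fin n) : flipBit (flipBit x i) i = x := by
  simp [flipBit]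

theorem flipBit_comm {n : ℕ} (x : Cube n) (i j : Fin n) :
    flipBit (flipBit x i) j = flipBit (flipBit x j) i := by
  rcases eq_or_ne i j with rfl | h
  · rfl
  · simp only [flipBit, Function.update_of_ne h.symm, Function.update_of_ne h]
    exact Function.update_comm h.symm _ _ _ |>.symm

theorem flipBit_injective {n : ℕ} (x : Cube n) : Function.Injective (flipBit x) := fun i j h => by
  by_contra hij
  have := congrFun h i
  simp [flipBit, hij] at this

theorem sum_flipBit {n : ℕ} {M : Type*} [AddCommMonoid M] (i : Fin n) (g : Cube n → M) :
    ∑ x, g (flipBit x i) = ∑ x, g x :=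
  Fintype.sum_equiv (Function.Involutive.toPerm (fun x => flipBit x i)
    fun x => flipBit_flipBit x i) _ _ fun _ => rfl

theorem sum_sum_flipBit {n : ℕ} {M : Type*} [AddCommMonoid M] (g : Fin n → Cube n → M) :
    ∑ x, ∑ i, g i (flipBit x i) = ∑ x, ∑ i, g i x :=
  Finset.sum_comm.trans
    ((Finset.sum_congr rfl fun i _ => sum_flipBit i (g i)).trans Finset.sum_comm)

theorem sum_cube_succ {n : ℕ} (g : Cube (n + 1) → ℝ) :
    ∑ x, g x = ∑ x : Cube n, g (Fin.cons false x) + ∑ x : Cube n, g (Fin.cons true x) := by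
  rw [← (Fin.consEquiv fun _ : Fin (n + 1) => Bool).sum_comp, Fintype.sum_prod_type,
    Fintype.sum_bool, add_comm]
  rfl

theorem flipBit_cons_zero {n : ℕ} (b : Bool) (x : Cube n) :
    flipBit (Fin.cons b x : Cube (n + 1)) 0 = Fin.cons (!b) x := by
  simp [flipBit, Fin.update_cons_zero]

theorem flipBit_cons_succ {n : ℕ} (b : Bool) (x : Cube n) (i : Fin n) :
    flipBit (Fin.cons b x : Cube (n + 1)) i.succ = Fin.cons b (flipBit x i) := by
  simp [flipBit, Fin.cons_update]

/-- Induction on the first bit. The variance splits into those of the two halves plus the squared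
difference of their sums, which Cauchy–Schwarz bounds by the edges in direction `0`. Each edge is
counted twice on the right. -/
theorem card_mul_sum_sq_sub_sq_sum_le :
    ∀ {n : ℕ} (F : Cube n → ℝ), 2 ^ n * ∑ x, F x ^ 2 - (∑ x, F x) ^ 2 ≤
      2 ^ n / 4 * ∑ x, ∑ i, (F x - F (flipBit x i)) ^ 2
  | 0, F => by simp
  | n + 1, F => by
    have h0 := card_mul_sum_sq_sub_sq_sum_le fun x : Cube n => F (Fin.cons false x)
    have h1 := card_mul_sum_sq_sub_sq_sum_le fun x : Cube n => F (Fin.cons true x)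
    have hcs : (∑ x : Cube n, (F (Fin.cons false x) - F (Fin.cons true x))) ^ 2 ≤
        2 ^ n * ∑ x : Cube n, (F (Fin.cons false x) - F (Fin.cons true x)) ^ 2 := by
      simpa using sq_sum_le_card_mul_sum_sq (s := (Finset.univ : Finset (Cube n)))
        (f := fun x => F (Fin.cons false x) - F (Fin.cons true x))
    have hsymm : ∑ x : Cube n, (F (Fin.cons true x) - F (Fin.cons false x)) ^ 2 =
        ∑ x : Cube n, (F (Fin.cons false x) - F (Fin.cons true x)) ^ 2 :=
      Finset.sum_congr rfl fun x _ => sub_sq_comm _ _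
    simp only [sum_cube_succ, Fin.sum_univ_succ, flipBit_cons_zero, flipBit_cons_succ,
      Finset.sum_add_distrib, Bool.not_false, Bool.not_true, hsymm]
    rw [Finset.sum_sub_distrib] at hcs
    rw [pow_succ]
    nlinarith

/-- The Poincaré inequality of the hypercube. -/
theorem exists_sum_sub_sq_le {n : ℕ} (F : Cube n → ℝ) :
    ∃ m : ℝ, ∑ x, (F x - m) ^ 2 ≤ 1 / 4 * ∑ x, ∑ i, (F x - F (flipBit x i)) ^ 2 := by
  have hN : (0 : ℝ) < 2 ^ n := by positivity
  refine ⟨(∑ x, F x) / 2 ^ n, le_of_mul_le_mul_left ?_ hN⟩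
  have h : ∑ x, (F x - (∑ x, F x) / 2 ^ n) ^ 2 =
      ∑ x, F x ^ 2 - (∑ x, F x) ^ 2 / 2 ^ n := by
    simp only [sub_sq, Finset.sum_add_distrib, Finset.sum_sub_distrib, ← Finset.sum_mul,
      ← Finset.mul_sum, Finset.sum_const, Finset.card_univ, Fintype.card_pi, Fintype.card_bool,
      Finset.prod_const, Fintype.card_fin, nsmul_eq_mul]
    push_cast
    field_simp
    ring
  rw [h, mul_sub, mul_div_cancel₀ _ hN.ne']
  linarith [card_mul_sum_sq_sub_sq_sum_le F]

/-! ### Poincaré inequality on a dense subset of the hypercube -/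

section Dense

variable {n : ℕ} {χ : Cube n → ℝ}

/-- The energy of `f` on the edges of a (fuzzy) subset of the hypercube. -/
def subsetEnergy (χ f : Cube n → ℝ) : ℝ :=
  ∑ x, ∑ i, χ x * χ (flipBit x i) * (f x - f (flipBit x i)) ^ 2

/-- The average of `f` over the neighbours of `x` in a (fuzzy) subset of the hypercube. -/
noncomputable def nbrAverage (χ f : Cube n → ℝ) (x : Cube n) : ℝ :=
  (∑ i, χ (flipBit x i) * f (flipBit x i)) / ∑ i, χ (flipBit x i)

/-- A union bound over directions: each of the three vertices loses at most `n / 8` of them, which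
leaves at least `5 n / 8`. The inequality `p + q + r - 2 ≤ p q r` on `[0, 1]` is its fuzzy form. -/
theorem common_neighbor_sum_ge (h1 : ∀ x, χ x ≤ 1) (h0 : ∀ x, 0 ≤ χ x)
    (hd : ∀ x, 7 / 8 * (n : ℝ) ≤ ∑ i, χ (flipBit x i)) (x y z : Cube n) :
    (n : ℝ) / 2 ≤ ∑ l, χ (flipBit x l) * χ (flipBit y l) * χ (flipBit z l) := by
  have h : ∀ l, χ (flipBit x l) + χ (flipBit y l) + χ (flipBit z l) - 2 ≤
      χ (flipBit x l) * χ (flipBit y l) * χ (flipBit z l) := fun l => by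
    have ha := h1 (flipBit x l)
    have hb := h1 (flipBit y l)
    have hc := h1 (flipBit z l)
    have := h0 (flipBit x l)
    have := h0 (flipBit y l)
    nlinarith [mul_nonneg (sub_nonneg.2 ha) (sub_nonneg.2 hb),
      mul_nonneg (sub_nonneg.2 hc) (sub_nonneg.2 (mul_le_one₀ ha (h0 _) hb))]
  refine le_trans ?_ (Finset.sum_le_sum fun l _ => h l)
  simp only [Finset.sum_add_distrib, Finset.sum_sub_distrib, Finset.sum_const, Finset.card_univ,
    Fintype.card_fin, nsmul_eq_mul]
  have := hd x
  have := hd y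
  have := hd z
  have : (0 : ℝ) ≤ n := n.cast_nonneg
  linarith

theorem pair_neighbor_sum_ge (h1 : ∀ x, χ x ≤ 1) (h0 : ∀ x, 0 ≤ χ x)
    (hd : ∀ x, 7 / 8 * (n : ℝ) ≤ ∑ i, χ (flipBit x i)) (x y : Cube n) :
    (n : ℝ) / 2 ≤ ∑ l, χ (flipBit x l) * χ (flipBit y l) := by
  refine (common_neighbor_sum_ge h1 h0 hd x y y).trans (Finset.sum_le_sum fun l _ => ?_)
  exact mul_le_of_le_one_right (mul_nonneg (h0 _) (h0 _)) (h1 _)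

/-- Differences of `f` on pairs of neighbours of `x` that are joined by a common neighbour. -/
def pathEnergy (χ f : Cube n → ℝ) (x : Cube n) : ℝ :=
  ∑ i, ∑ l, χ (flipBit x i) * χ (flipBit x l) * χ (flipBit (flipBit x i) l) *
    (f (flipBit x i) - f (flipBit x l)) ^ 2

/-- Two good neighbours of `x` in directions `i` and `k` are compared through a third one in
direction `l`, chosen so that the far corners of the squares `(i, l)` and `(k, l)` are good too.
Averaging over the at least `n / 2` available `l` gives the bound. -/
theorem sum_pair_le_pathEnergy (hn : 0 < n) (h1 : ∀ x, χ x ≤ 1) (h0 : ∀ x, 0 ≤ χ x)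
    (hd : ∀ x, 7 / 8 * (n : ℝ) ≤ ∑ i, χ (flipBit x i)) (f : Cube n → ℝ) (x : Cube n) :
    ∑ i, ∑ k, χ (flipBit x i) * χ (flipBit x k) * (f (flipBit x i) - f (flipBit x k)) ^ 2 ≤
      8 * pathEnergy χ f x := by
  have hn' : (0 : ℝ) < n := Nat.cast_pos.2 hn
  have key : ∀ i k, (n : ℝ) / 2 *
      (χ (flipBit x i) * χ (flipBit x k) * (f (flipBit x i) - f (flipBit x k)) ^ 2) ≤
      2 * (∑ l, χ (flipBit x i) * χ (flipBit x l) * χ (flipBit (flipBit x i) l) *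
        (f (flipBit x i) - f (flipBit x l)) ^ 2) +
      2 * (∑ l, χ (flipBit x k) * χ (flipBit x l) * χ (flipBit (flipBit x k) l) *
        (f (flipBit x k) - f (flipBit x l)) ^ 2) := fun i k => by
    have hc := common_neighbor_sum_ge h1 h0 hd x (flipBit x i) (flipBit x k)
    have hp : 0 ≤ χ (flipBit x i) * χ (flipBit x k) *
        (f (flipBit x i) - f (flipBit x k)) ^ 2 :=
      mul_nonneg (mul_nonneg (h0 _) (h0 _)) (sq_nonneg _)
    refine (mul_le_mul_of_nonneg_right hc hp).trans ?_
    rw [Finset.sum_mul, Finset.mul_sum, Finset.mul_sum, ← Finset.sum_add_distrib]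
    refine Finset.sum_le_sum fun l _ => ?_
    generalize f (flipBit x i) = a, f (flipBit x k) = b, f (flipBit x l) = c
    have hi := h0 (flipBit x i)
    have hk := h0 (flipBit x k)
    have hl := h0 (flipBit x l)
    have hil := h0 (flipBit (flipBit x i) l)
    have hkl := h0 (flipBit (flipBit x k) l)
    have hi' := h1 (flipBit x i)
    have hk' := h1 (flipBit x k)
    have hil' := h1 (flipBit (flipBit x i) l)
    have hkl' := h1 (flipBit (flipBit x k) l)
    generalize χ (flipBit x i) = p, χ (flipBit x k) = q, χ (flipBit x l) = r,
      χ (flipBit (flipBit x i) l) = s, χ (flipBit (flipBit x k) l) = t at *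
    have e1 : (a - b) ^ 2 ≤ 2 * (a - c) ^ 2 + 2 * (b - c) ^ 2 := by
      nlinarith [sq_nonneg (a + b - 2 * c)]
    have e2 : r * s * t * (p * q) ≤ p * r * s := by
      have := mul_le_one₀ hk' hkl hkl'
      nlinarith [mul_le_mul_of_nonneg_left this (mul_nonneg (mul_nonneg hi hl) hil)]
    have e3 : r * s * t * (p * q) ≤ q * r * t := by
      have := mul_le_one₀ hi' hil hil'
      nlinarith [mul_le_mul_of_nonneg_left this (mul_nonneg (mul_nonneg hk hl) hkl)]
    have e4 : 0 ≤ r * s * t * (p * q) := by positivity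
    calc r * s * t * (p * q * (a - b) ^ 2) = r * s * t * (p * q) * (a - b) ^ 2 := by ring
      _ ≤ r * s * t * (p * q) * (2 * (a - c) ^ 2 + 2 * (b - c) ^ 2) := by gcongr
      _ = 2 * (r * s * t * (p * q) * (a - c) ^ 2) + 2 * (r * s * t * (p * q) * (b - c) ^ 2) := by
        ring
      _ ≤ _ := by gcongr
  have hsum := Finset.sum_le_sum fun i (_ : i ∈ Finset.univ) =>
    Finset.sum_le_sum fun k (_ : k ∈ Finset.univ) => key i k
  simp only [Finset.sum_add_distrib, ← Finset.mul_sum, Finset.sum_const, Finset.card_univ,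
    Fintype.card_fin, nsmul_eq_mul] at hsum
  refine le_of_mul_le_mul_left ?_ (half_pos hn')
  rw [pathEnergy]
  linarith

/-- Neighbours of `x` are joined through the opposite corner of their square, since `x` itself may
be bad. Each half of the detour is a good edge, and translation by a bit flip turns the sum over `x`
into `subsetEnergy`. -/
theorem sum_pathEnergy_le (h1 : ∀ x, χ x ≤ 1) (h0 : ∀ x, 0 ≤ χ x) (f : Cube n → ℝ) :
    ∑ x, pathEnergy χ f x ≤ 4 * n * subsetEnergy χ f := by
  have hE : ∀ i : Fin n, ∑ x, ∑ l, χ (flipBit x i) * χ (flipBit (flipBit x i) l) *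
      (f (flipBit x i) - f (flipBit (flipBit x i) l)) ^ 2 = subsetEnergy χ f := fun i =>
    sum_flipBit i fun y => ∑ l, χ y * χ (flipBit y l) * (f y - f (flipBit y l)) ^ 2
  have key : ∀ x, pathEnergy χ f x ≤
      2 * (∑ i, ∑ l, χ (flipBit x i) * χ (flipBit (flipBit x i) l) *
        (f (flipBit x i) - f (flipBit (flipBit x i) l)) ^ 2) +
      2 * (∑ i, ∑ l, χ (flipBit x l) * χ (flipBit (flipBit x l) i) *
        (f (flipBit x l) - f (flipBit (flipBit x l) i)) ^ 2) := fun x => by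
    rw [pathEnergy, Finset.mul_sum, Finset.mul_sum, ← Finset.sum_add_distrib]
    refine Finset.sum_le_sum fun i _ => ?_
    rw [Finset.mul_sum, Finset.mul_sum, ← Finset.sum_add_distrib]
    refine Finset.sum_le_sum fun l _ => ?_
    rw [flipBit_comm x l i]
    have hi := h0 (flipBit x i)
    have hl := h0 (flipBit x l)
    have hil := h0 (flipBit (flipBit x i) l)
    have hi' := h1 (flipBit x i)
    have hl' := h1 (flipBit x l)
    generalize f (flipBit x i) = a, f (flipBit x l) = b, f (flipBit (flipBit x i) l) = c
    generalize χ (flipBit x i) = p, χ (flipBit x l) = q, χ (flipBit (flipBit x i) l) = r at *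
    have e1 : (a - b) ^ 2 ≤ 2 * (a - c) ^ 2 + 2 * (b - c) ^ 2 := by
      nlinarith [sq_nonneg (a + b - 2 * c)]
    have e2 : p * q * r ≤ p * r := by
      nlinarith [mul_le_mul_of_nonneg_left hl' (mul_nonneg hi hil)]
    have e3 : p * q * r ≤ q * r := by
      nlinarith [mul_le_mul_of_nonneg_left hi' (mul_nonneg hl hil)]
    have e4 : 0 ≤ p * q * r := by positivity
    calc p * q * r * (a - b) ^ 2 ≤ p * q * r * (2 * (a - c) ^ 2 + 2 * (b - c) ^ 2) := by gcongr
      _ = 2 * (p * q * r * (a - c) ^ 2) + 2 * (p * q * r * (b - c) ^ 2) := by ring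
      _ ≤ _ := by gcongr
  refine (Finset.sum_le_sum fun x _ => key x).trans (le_of_eq ?_)
  rw [Finset.sum_add_distrib, ← Finset.mul_sum, ← Finset.mul_sum]
  have hA : ∑ x, ∑ i, ∑ l, χ (flipBit x i) * χ (flipBit (flipBit x i) l) *
      (f (flipBit x i) - f (flipBit (flipBit x i) l)) ^ 2 = n * subsetEnergy χ f := by
    rw [Finset.sum_comm]
    simp only [hE, Finset.sum_const, Finset.card_univ, Fintype.card_fin, nsmul_eq_mul]
  have hB : ∑ x, ∑ i, ∑ l, χ (flipBit x l) * χ (flipBit (flipBit x l) i) *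
      (f (flipBit x l) - f (flipBit (flipBit x l) i)) ^ 2 = n * subsetEnergy χ f := by
    rw [← hA]
    exact Finset.sum_congr rfl fun x _ => Finset.sum_comm
  rw [hA, hB]
  ring

/-- The deviation from the local average is a variance, so total weight times it is half the sum of
squared differences over pairs of neighbours. -/
theorem sum_nbrAverage_sub_sq_le (hn : 0 < n) (h1 : ∀ x, χ x ≤ 1) (h0 : ∀ x, 0 ≤ χ x)
    (hd : ∀ x, 7 / 8 * (n : ℝ) ≤ ∑ i, χ (flipBit x i)) (f : Cube n → ℝ) :
    ∑ x, ∑ i, χ (flipBit x i) * (nbrAverage χ f x - f (flipBit x i)) ^ 2 ≤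
      64 * subsetEnergy χ f := by
  have hn' : (0 : ℝ) < n := Nat.cast_pos.2 hn
  have key : ∀ x, (n : ℝ) / 2 *
      ∑ i, χ (flipBit x i) * (nbrAverage χ f x - f (flipBit x i)) ^ 2 ≤
        8 * pathEnergy χ f x := fun x => by
    refine le_trans ?_ (sum_pair_le_pathEnergy hn h1 h0 hd f x)
    have hW : (n : ℝ) / 2 ≤ ∑ i, χ (flipBit x i) := by linarith [hd x]
    have hWp : 0 < ∑ i, χ (flipBit x i) := by linarith
    have hnn : 0 ≤ ∑ i, χ (flipBit x i) * (nbrAverage χ f x - f (flipBit x i)) ^ 2 :=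
      Finset.sum_nonneg fun i _ => mul_nonneg (h0 _) (sq_nonneg _)
    refine (mul_le_mul_of_nonneg_right hW hnn).trans ?_
    have hav : (∑ i, χ (flipBit x i)) * nbrAverage χ f x =
        ∑ i, χ (flipBit x i) * f (flipBit x i) := mul_div_cancel₀ _ hWp.ne'
    have hS : ∑ i, χ (flipBit x i) * (nbrAverage χ f x - f (flipBit x i)) ^ 2 =
        ∑ i, χ (flipBit x i) * f (flipBit x i) ^ 2 -
          (∑ i, χ (flipBit x i)) * nbrAverage χ f x ^ 2 := by
      have : ∀ i, χ (flipBit x i) * (nbrAverage χ f x - f (flipBit x i)) ^ 2 =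
          χ (flipBit x i) * nbrAverage χ f x ^ 2 -
          2 * nbrAverage χ f x * (χ (flipBit x i) * f (flipBit x i)) +
          χ (flipBit x i) * f (flipBit x i) ^ 2 := fun i => by ring
      simp only [this, Finset.sum_add_distrib, Finset.sum_sub_distrib, ← Finset.mul_sum,
        ← Finset.sum_mul, ← hav]
      ring
    have hD : ∑ i, ∑ k, χ (flipBit x i) * χ (flipBit x k) *
        (f (flipBit x i) - f (flipBit x k)) ^ 2 =
        2 * ((∑ i, χ (flipBit x i)) * ∑ i, χ (flipBit x i) * f (flipBit x i) ^ 2 -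
          (∑ i, χ (flipBit x i) * f (flipBit x i)) ^ 2) := by
      have : ∀ i k, χ (flipBit x i) * χ (flipBit x k) * (f (flipBit x i) - f (flipBit x k)) ^ 2 =
          χ (flipBit x i) * f (flipBit x i) ^ 2 * χ (flipBit x k) +
          χ (flipBit x i) * (χ (flipBit x k) * f (flipBit x k) ^ 2) -
          2 * ((χ (flipBit x i) * f (flipBit x i)) * (χ (flipBit x k) * f (flipBit x k))) :=
        fun i k => by ring
      simp only [this, Finset.sum_add_distrib, Finset.sum_sub_distrib, ← Finset.mul_sum,
        ← Finset.sum_mul]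
      ring
    have hDnn : 0 ≤ ∑ i, ∑ k, χ (flipBit x i) * χ (flipBit x k) *
        (f (flipBit x i) - f (flipBit x k)) ^ 2 :=
      Finset.sum_nonneg fun i _ => Finset.sum_nonneg fun k _ =>
        mul_nonneg (mul_nonneg (h0 _) (h0 _)) (sq_nonneg _)
    rw [hD] at hDnn ⊢
    rw [hS, ← hav] at *
    nlinarith
  refine le_of_mul_le_mul_left ?_ (half_pos hn')
  rw [Finset.mul_sum]
  refine (Finset.sum_le_sum fun x _ => key x).trans ?_
  rw [← Finset.mul_sum]
  linarith [sum_pathEnergy_le h1 h0 f]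

/-- With `y = flipBit x k`, go from `F x` to `f (flipBit x i)`, across a good edge in direction `k`
to `f (flipBit y i)`, then to `F y`, averaging over the directions `i` good at both ends. The
constant is `2 · 3 · (64 + 1 + 64)`. -/
theorem sum_nbrAverage_grad_le (hn : 0 < n) (h1 : ∀ x, χ x ≤ 1) (h0 : ∀ x, 0 ≤ χ x)
    (hd : ∀ x, 7 / 8 * (n : ℝ) ≤ ∑ i, χ (flipBit x i)) (f : Cube n → ℝ) :
    ∑ x, ∑ k, (nbrAverage χ f x - nbrAverage χ f (flipBit x k)) ^ 2 ≤
      774 * subsetEnergy χ f := by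
  have hn' : (0 : ℝ) < n := Nat.cast_pos.2 hn
  have hS := sum_nbrAverage_sub_sq_le hn h1 h0 hd f
  set F := nbrAverage χ f with hF
  have key : ∀ x k, (n : ℝ) / 2 * (F x - F (flipBit x k)) ^ 2 ≤
      3 * (∑ i, χ (flipBit x i) * (F x - f (flipBit x i)) ^ 2) +
      3 * (∑ i, χ (flipBit x i) * χ (flipBit (flipBit x i) k) *
        (f (flipBit x i) - f (flipBit (flipBit x i) k)) ^ 2) +
      3 * (∑ i, χ (flipBit (flipBit x k) i) *
        (F (flipBit x k) - f (flipBit (flipBit x k) i)) ^ 2) := fun x k => by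
    have hc := pair_neighbor_sum_ge h1 h0 hd x (flipBit x k)
    refine (mul_le_mul_of_nonneg_right hc (sq_nonneg _)).trans ?_
    rw [Finset.sum_mul, Finset.mul_sum, Finset.mul_sum, Finset.mul_sum,
      ← Finset.sum_add_distrib, ← Finset.sum_add_distrib]
    refine Finset.sum_le_sum fun i _ => ?_
    rw [flipBit_comm x k i]
    have hp := h0 (flipBit x i)
    have hp' := h1 (flipBit x i)
    have hq := h0 (flipBit (flipBit x i) k)
    have hq' := h1 (flipBit (flipBit x i) k)
    generalize F x = a, F (flipBit x k) = b, f (flipBit x i) = c,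
      f (flipBit (flipBit x i) k) = d
    generalize χ (flipBit x i) = p, χ (flipBit (flipBit x i) k) = q at *
    have e1 : (a - b) ^ 2 ≤ 3 * (a - c) ^ 2 + 3 * (c - d) ^ 2 + 3 * (b - d) ^ 2 := by
      nlinarith [sq_nonneg ((a - c) - (c - d)), sq_nonneg ((c - d) - (d - b)),
        sq_nonneg ((a - c) - (d - b))]
    have e2 : p * q ≤ p := mul_le_of_le_one_right hp hq'
    have e3 : p * q ≤ q := mul_le_of_le_one_left hq hp'
    have e4 : 0 ≤ p * q := by positivity
    calc p * q * (a - b) ^ 2 ≤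
        p * q * (3 * (a - c) ^ 2 + 3 * (c - d) ^ 2 + 3 * (b - d) ^ 2) := by gcongr
      _ = 3 * (p * q * (a - c) ^ 2) + 3 * (p * q * (c - d) ^ 2) +
          3 * (p * q * (b - d) ^ 2) := by ring
      _ ≤ _ := by gcongr
  have hA : ∑ x, ∑ k : Fin n, ∑ i, χ (flipBit x i) * (F x - f (flipBit x i)) ^ 2 =
      n * ∑ x, ∑ i, χ (flipBit x i) * (F x - f (flipBit x i)) ^ 2 := by
    simp only [Finset.sum_const, Finset.card_univ, Fintype.card_fin, nsmul_eq_mul,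
      ← Finset.mul_sum]
  have hC : ∑ x, ∑ k, ∑ i, χ (flipBit (flipBit x k) i) *
      (F (flipBit x k) - f (flipBit (flipBit x k) i)) ^ 2 =
      n * ∑ x, ∑ i, χ (flipBit x i) * (F x - f (flipBit x i)) ^ 2 := by
    rw [← hA]
    exact sum_sum_flipBit fun _ y => ∑ i, χ (flipBit y i) * (F y - f (flipBit y i)) ^ 2
  have hB : ∑ x, ∑ k, ∑ i, χ (flipBit x i) * χ (flipBit (flipBit x i) k) *
        (f (flipBit x i) - f (flipBit (flipBit x i) k)) ^ 2 = n * subsetEnergy χ f := by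
    have hE : ∀ i : Fin n, ∑ x, ∑ k, χ (flipBit x i) * χ (flipBit (flipBit x i) k) *
      (f (flipBit x i) - f (flipBit (flipBit x i) k)) ^ 2 = subsetEnergy χ f := fun i =>
      sum_flipBit i fun y => ∑ l, χ y * χ (flipBit y l) * (f y - f (flipBit y l)) ^ 2
    rw [Finset.sum_congr rfl fun x _ => Finset.sum_comm, Finset.sum_comm]
    simp only [hE, Finset.sum_const, Finset.card_univ, Fintype.card_fin, nsmul_eq_mul]
  have hsum := Finset.sum_le_sum fun x (_ : x ∈ Finset.univ) =>
    Finset.sum_le_sum fun k (_ : k ∈ Finset.univ) => key x k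
  simp only [Finset.sum_add_distrib, ← Finset.mul_sum] at hsum
  rw [hA, hB, hC] at hsum
  refine le_of_mul_le_mul_left (hsum.trans ?_) (half_pos hn')
  nlinarith

end Dense

/-- A weighted Poincaré inequality: the weights `w` are bounded by `M`, and at most an eighth of the
neighbours of any vertex have weight below `θ`. -/
theorem exists_weighted_poincare {n : ℕ} (hn : 0 < n) {w : Cube n → ℝ} {θ M : ℝ} (hθ : 0 < θ)
    (hw : ∀ x, 0 < w x) (hM : ∀ x, w x ≤ M)
    (hd : ∀ x, 7 / 8 * (n : ℝ) ≤ ∑ i, if θ ≤ w (flipBit x i) then (1 : ℝ) else 0)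
    (f : Cube n → ℝ) :
    ∃ m : ℝ, ∑ x, w x * (f x - m) ^ 2 ≤ 4000 * (M / θ) *
      ∑ x, ∑ i, w x * w (flipBit x i) / (w x + w (flipBit x i)) *
        (f x - f (flipBit x i)) ^ 2 := by
  have hn' : (1 : ℝ) ≤ n := Nat.one_le_cast.2 hn
  set χ : Cube n → ℝ := fun x => if θ ≤ w x then 1 else 0 with hχ
  have h0 : ∀ x, 0 ≤ χ x := fun x => by simp only [hχ]; split_ifs <;> norm_num
  have h1 : ∀ x, χ x ≤ 1 := fun x => by simp only [hχ]; split_ifs <;> norm_num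
  set D := ∑ x, ∑ i, w x * w (flipBit x i) / (w x + w (flipBit x i)) *
        (f x - f (flipBit x i)) ^ 2 with hDdef
  obtain ⟨m, hm⟩ := exists_sum_sub_sq_le (nbrAverage χ f)
  have hS := sum_nbrAverage_sub_sq_le hn h1 h0 hd f
  have hG := sum_nbrAverage_grad_le hn h1 h0 hd f
  set F := nbrAverage χ f
  have hM0 : 0 < M := (hw fun _ => false).trans_le (hM _)
  -- An edge with both ends of weight at least `θ` has conductance at least `θ / 2`.
  have hE : subsetEnergy χ f ≤ 2 / θ * D := by
    rw [subsetEnergy, hDdef, Finset.mul_sum]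
    refine Finset.sum_le_sum fun x _ => ?_
    rw [Finset.mul_sum]
    refine Finset.sum_le_sum fun i _ => ?_
    rw [← mul_assoc]
    refine mul_le_mul_of_nonneg_right ?_ (sq_nonneg _)
    have ha := hw x
    have hb := hw (flipBit x i)
    simp only [hχ]
    split_ifs with h2 h3
    · rw [div_mul_div_comm, le_div_iff₀ (by positivity)]
      nlinarith
    all_goals simp only [mul_zero, zero_mul]; positivity
  -- Only the neighbour has to be good here: the conductance is at least `w x * θ / (2 * M)`, so a
  -- vertex of tiny weight does no harm.
  have hL : ∑ x, ∑ i, χ (flipBit x i) * w x * (f x - f (flipBit x i)) ^ 2 ≤ 2 * M / θ * D := by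
    rw [hDdef, Finset.mul_sum]
    refine Finset.sum_le_sum fun x _ => ?_
    rw [Finset.mul_sum]
    refine Finset.sum_le_sum fun i _ => ?_
    rw [← mul_assoc]
    refine mul_le_mul_of_nonneg_right ?_ (sq_nonneg _)
    have ha := hw x
    have hb := hw (flipBit x i)
    have ha' := hM x
    have hb' := hM (flipBit x i)
    simp only [hχ]
    split_ifs with h2
    · rw [div_mul_div_comm, le_div_iff₀ (by positivity)]
      have : θ * (w x + w (flipBit x i)) ≤ w (flipBit x i) * (2 * M) :=
        mul_le_mul h2 (by linarith) (by linarith) hb.le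
      nlinarith [mul_le_mul_of_nonneg_left this ha.le]
    · simp only [zero_mul]; positivity
  -- Split `f x - m` through a good neighbour's value of `f` and then through `F x`.
  have key : ∀ x, (n : ℝ) / 2 * (w x * (f x - m) ^ 2) ≤
      3 * (∑ i, χ (flipBit x i) * w x * (f x - f (flipBit x i)) ^ 2) +
      3 * M * (∑ i, χ (flipBit x i) * (F x - f (flipBit x i)) ^ 2) +
      3 * n * M * (F x - m) ^ 2 := fun x => by
    have hc : (n : ℝ) / 2 ≤ ∑ i, χ (flipBit x i) := by linarith [hd x]
    refine (mul_le_mul_of_nonneg_right hc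
      (mul_nonneg (hw x).le (sq_nonneg _))).trans ?_
    have hlast : 3 * n * M * (F x - m) ^ 2 = ∑ _i : Fin n, 3 * M * (F x - m) ^ 2 := by
      simp only [Finset.sum_const, Finset.card_univ, Fintype.card_fin, nsmul_eq_mul]; ring
    rw [hlast, Finset.sum_mul, Finset.mul_sum, Finset.mul_sum,
      ← Finset.sum_add_distrib, ← Finset.sum_add_distrib]
    refine Finset.sum_le_sum fun i _ => ?_
    have hp := h0 (flipBit x i)
    have hp' := h1 (flipBit x i)
    have hwx := (hw x).le
    have hwM := hM x
    generalize f x = a, F x = b, f (flipBit x i) = c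
    generalize χ (flipBit x i) = p, w x = u at *
    have e1 : (a - m) ^ 2 ≤ 3 * (a - c) ^ 2 + 3 * (b - c) ^ 2 + 3 * (b - m) ^ 2 := by
      nlinarith [sq_nonneg ((a - c) - (c - b)), sq_nonneg ((c - b) - (b - m)),
        sq_nonneg ((a - c) - (b - m))]
    have e2 : p * u ≤ M * p := by nlinarith
    have e3 : p * u ≤ M := (mul_le_of_le_one_left hwx hp').trans hwM
    calc p * (u * (a - m) ^ 2) = p * u * (a - m) ^ 2 := by ring
      _ ≤ p * u * (3 * (a - c) ^ 2 + 3 * (b - c) ^ 2 + 3 * (b - m) ^ 2) := by gcongr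
      _ = 3 * (p * u * (a - c) ^ 2) + 3 * (p * u * (b - c) ^ 2) +
          3 * (p * u * (b - m) ^ 2) := by ring
      _ ≤ 3 * (p * u * (a - c) ^ 2) + 3 * (M * p * (b - c) ^ 2) +
          3 * (M * (b - m) ^ 2) := by gcongr
      _ = _ := by ring
  refine ⟨m, le_of_mul_le_mul_left ?_ (half_pos (zero_lt_one.trans_le hn'))⟩
  rw [Finset.mul_sum]
  refine (Finset.sum_le_sum fun x _ => key x).trans ?_
  simp only [Finset.sum_add_distrib, ← Finset.mul_sum]
  have hD0 : 0 ≤ D := Finset.sum_nonneg fun x _ => Finset.sum_nonneg fun i _ => by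
    have := hw x
    have := hw (flipBit x i)
    positivity
  have hS' : M * (∑ x, ∑ i, χ (flipBit x i) * (F x - f (flipBit x i)) ^ 2) ≤
      128 * (M / θ * D) := by
    calc _ ≤ M * (64 * (2 / θ * D)) := by gcongr; linarith
      _ = _ := by ring
  have hG' : M * ∑ x, (F x - m) ^ 2 ≤ 387 * (M / θ * D) := by
    calc _ ≤ M * (1 / 4 * (774 * (2 / θ * D))) := by gcongr; linarith
      _ = _ := by ring
  have hL' : 2 * M / θ * D = 2 * (M / θ * D) := by ring
  have hQ : 0 ≤ M / θ * D := by positivity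
  nlinarith [mul_le_mul_of_nonneg_left hG' (by linarith : (0 : ℝ) ≤ n),
    mul_le_mul_of_nonneg_right hn' hQ]

end ShadowOverlap

namespace ShadowOverlap

open MeasureTheory

/-! ### Typical measurement distributions -/

theorem sum_measDist {n : ℕ} (ψ : PureState n) : ∑ x, ‖ψ.1 x‖ ^ 2 = 1 := by
  rw [← EuclideanSpace.norm_sq_eq, mem_sphere_zero_iff_norm.1 ψ.2, one_pow]

theorem haarState_amplitude_eq_zero_le {n : ℕ} (x : Cube n) :
    haarState n {ψ | ψ.1 x = 0} ≤ ENNReal.ofReal (16 ^ n)⁻¹ := by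
  have hK : (0 : ℝ) < 16 ^ n := by positivity
  refine (measure_mono fun ψ hψ => ?_).trans
    -- Any large coefficient would do; `16 ^ n` leaves room for the union bound over `2 ^ n`
    -- vertices.
    ((haarState_quadratic_nonpos_le (fun y => if y = x then 16 ^ n else 0) fun y => ?_).trans
      (ENNReal.ofReal_le_ofReal ?_))
  · have h0 : ψ.1 x = 0 := hψ
    simp [h0]
  · split_ifs <;> linarith
  · rw [Finset.prod_eq_single x (fun y _ hy => by simp [hy]) (by simp), if_pos rfl]
    exact inv_anti₀ hK (by linarith)

theorem inv_exp_three_le : Real.exp (-3) ≤ 1 / 16 := by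
  have h : (16 : ℝ) ≤ Real.exp 3 := by
    have h1 : (2.7 : ℝ) ^ 3 ≤ Real.exp 1 ^ 3 := by
      gcongr
      linarith [Real.exp_one_gt_d9]
    rw [← Real.exp_nat_mul] at h1
    norm_num at h1
    linarith
  rw [Real.exp_neg, one_div]
  exact inv_anti₀ (by norm_num) h

theorem haarState_amplitude_large_le {n : ℕ} (hn : 6 * (n : ℝ) ≤ 2 ^ n) (x : Cube n) :
    haarState n {ψ | 12 * n / 2 ^ n ≤ ‖ψ.1 x‖ ^ 2} ≤ ENNReal.ofReal (2 * (16 ^ n)⁻¹) := by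
  have hN : (0 : ℝ) < 2 ^ n := by positivity
  -- With coefficients `u`, lowered by `1 / 2` at `x`, the form equals `u - ‖ψ x‖² / 2` on the
  -- sphere, and the product is at most `2 exp (-2ⁿ u / 2) = 2 exp (-3 n)`.
  set u : ℝ := 6 * n / 2 ^ n with hu
  have hu0 : 0 ≤ u := by positivity
  have hu1 : u ≤ 1 := (div_le_one hN).2 hn
  refine (measure_mono fun ψ hψ => ?_).trans
    ((haarState_quadratic_nonpos_le (fun y => u - if y = x then 1 / 2 else 0) fun y => ?_).trans
      (ENNReal.ofReal_le_ofReal ?_))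
  · have h0 : 12 * n / 2 ^ n ≤ ‖ψ.1 x‖ ^ 2 := hψ
    have h1 : 12 * n / 2 ^ n = 2 * u := by rw [hu]; ring
    simp only [sub_mul, Finset.sum_sub_distrib, ← Finset.mul_sum, ite_mul, zero_mul,
      Finset.sum_ite_eq', Finset.mem_univ, if_true, Set.mem_ofPred_eq, sum_measDist]
    linarith
  · split_ifs <;> linarith
  · have hterm : ∀ y : Cube n, (1 + (u - if y = x then 1 / 2 else 0))⁻¹ ≤
        (if y = x then 2 else 1) * Real.exp (-(u / 2)) := fun y => by
      have h1 : (1 + u)⁻¹ ≤ Real.exp (-(u / 2)) := by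
        have h2 := Real.add_one_le_exp (-(u / 2))
        refine le_trans ?_ h2
        rw [inv_le_iff_one_le_mul₀ (by linarith)]
        nlinarith
      split_ifs with hy
      · calc (1 + (u - 1 / 2))⁻¹ ≤ ((1 + u) / 2)⁻¹ := inv_anti₀ (by linarith) (by linarith)
          _ = 2 * (1 + u)⁻¹ := by rw [inv_div, div_eq_mul_inv]
          _ ≤ _ := by gcongr
      · simpa using h1
    refine (Finset.prod_le_prod (fun y _ => inv_nonneg.2 ?_) fun y _ => hterm y).trans ?_
    · split_ifs <;> linarith
    · rw [Finset.prod_mul_distrib, Finset.prod_ite_eq' Finset.univ x fun _ => (2 : ℝ),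
        if_pos (Finset.mem_univ x), Finset.prod_const, ← Real.exp_nat_mul, ← inv_pow]
      simp only [Finset.card_univ, Fintype.card_pi, Fintype.card_bool, Finset.prod_const,
        Fintype.card_fin]
      have h3 : (2 ^ n : ℕ) * (-(u / 2)) = n * (-3) := by
        rw [hu]; push_cast; field_simp; ring
      rw [h3, Real.exp_nat_mul]
      gcongr
      linarith [inv_exp_three_le]

theorem haarState_amplitudes_small_le {n : ℕ} (hn : 2 * ((n : ℝ) + 1) ≤ 2 ^ n)
    {J : Finset (Cube n)} (hJ : J.card = n / 8 + 1) :
    haarState n {ψ | ∀ y ∈ J, ‖ψ.1 y‖ ^ 2 ≤ 1 / (2 ^ 43 * 2 ^ n)} ≤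
      ENNReal.ofReal (32 ^ n)⁻¹ := by
  have hN : (0 : ℝ) < 2 ^ n := by positivity
  have hJn : (J.card : ℝ) ≤ n + 1 := by
    have : J.card ≤ n + 1 := by omega
    exact_mod_cast this
  -- The shift `u` balances the coefficient `2 ^ 43` on `J`. It costs `exp (2 |J|) ≤ 8 ^ |J|`,
  -- leaving `2 ^ (-40 |J|) ≤ 32 ^ (-n)` because `8 |J| ≥ n`; this beats the `4 ^ n` choices of a
  -- vertex and a set of directions.
  set u : ℝ := J.card / 2 ^ n with hu
  have hu0 : 0 ≤ u := by positivity
  have hu1 : u ≤ 1 / 2 := by rw [hu, div_le_iff₀ hN]; linarith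
  refine (measure_mono fun ψ hψ => ?_).trans
    ((haarState_quadratic_nonpos_le (fun y => (if y ∈ J then 2 ^ 43 else 0) - u) fun y => ?_).trans
      (ENNReal.ofReal_le_ofReal ?_))
  · have h0 : ∀ y ∈ J, ‖ψ.1 y‖ ^ 2 ≤ 1 / (2 ^ 43 * 2 ^ n) := hψ
    have h1 := Finset.sum_le_card_nsmul J _ _ h0
    rw [nsmul_eq_mul] at h1
    simp only [sub_mul, Finset.sum_sub_distrib, ← Finset.mul_sum, ite_mul, zero_mul,
      Finset.sum_ite_mem, Finset.univ_inter, Set.mem_ofPred_eq, sum_measDist]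
    have h2 : (2 : ℝ) ^ 43 * (J.card * (1 / (2 ^ 43 * 2 ^ n))) = u := by rw [hu]; field_simp
    linarith
  · split_ifs <;> linarith
  · have hterm : ∀ y : Cube n, (1 + ((if y ∈ J then 2 ^ 43 else 0) - u))⁻¹ ≤
        (if y ∈ J then (2 ^ 43)⁻¹ else 1) * Real.exp (2 * u) := fun y => by
      split_ifs with hy
      · have h1 : (1 : ℝ) ≤ Real.exp (2 * u) := Real.one_le_exp (by linarith)
        calc (1 + ((2 : ℝ) ^ 43 - u))⁻¹ ≤ (2 ^ 43)⁻¹ * 1 := by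
              rw [mul_one]; exact inv_anti₀ (by positivity) (by linarith)
          _ ≤ _ := by gcongr
      · have h2 := Real.add_one_le_exp (2 * u)
        rw [one_mul]
        refine le_trans ?_ h2
        rw [inv_le_iff_one_le_mul₀ (by linarith)]
        nlinarith
    refine (Finset.prod_le_prod (fun y _ => inv_nonneg.2 ?_) fun y _ => hterm y).trans ?_
    · split_ifs <;> linarith
    · rw [Finset.prod_mul_distrib, Finset.prod_ite_mem, Finset.univ_inter, Finset.prod_const,
        Finset.prod_const, ← Real.exp_nat_mul]
      simp only [Finset.card_univ, Fintype.card_pi, Fintype.card_bool, Finset.prod_const,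
        Fintype.card_fin]
      have h3 : (2 ^ n : ℕ) * (2 * u) = J.card * 2 := by
        rw [hu]; push_cast; field_simp
      have he : Real.exp 2 ≤ 8 := by
        have h1 : Real.exp 1 ^ 2 ≤ (2.72 : ℝ) ^ 2 := by
          gcongr
          linarith [Real.exp_one_lt_d9]
        rw [← Real.exp_nat_mul] at h1
        norm_num at h1
        linarith
      rw [h3, Real.exp_nat_mul, ← mul_pow]
      calc ((2 ^ 43 : ℝ)⁻¹ * Real.exp 2) ^ J.card ≤ ((2 ^ 43 : ℝ)⁻¹ * 8) ^ J.card := by gcongr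
        _ = (2 ^ (40 * J.card))⁻¹ := by
          rw [show ((2 : ℝ) ^ 43)⁻¹ * 8 = (2 ^ 40)⁻¹ by norm_num, inv_pow, ← pow_mul]
        _ ≤ (2 ^ (5 * n))⁻¹ := by
          apply inv_anti₀ (by positivity)
          apply pow_le_pow_right₀ (by norm_num)
          omega
        _ = (32 ^ n)⁻¹ := by rw [pow_mul]; norm_num

/-- The measurement distribution `π` is positive, bounded by `12 n 2⁻ⁿ`, and at least `2⁻ⁿ⁻⁴³` on
seven eighths of the neighbours of any vertex. -/
def Typical {n : ℕ} (ψ : PureState n) : Prop :=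
  ∀ x, 0 < measDist ψ x ∧ measDist ψ x ≤ 12 * n / 2 ^ n ∧
    7 / 8 * (n : ℝ) ≤ ∑ i, if 1 / (2 ^ 43 * 2 ^ n) ≤ measDist ψ (flipBit x i) then (1 : ℝ) else 0

theorem haarState_not_typical_le {n : ℕ} (hn : 5 ≤ n) :
    haarState n {ψ | ¬ Typical ψ} ≤ ENNReal.ofReal (2 ^ n)⁻¹ := by
  have hpow : ∀ n : ℕ, 5 ≤ n → 6 * (n : ℝ) ≤ 2 ^ n := fun n hn => by
    induction n, hn using Nat.le_induction with
    | base => norm_num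
    | succ k hk ih =>
      have : (5 : ℝ) ≤ k := by exact_mod_cast hk
      rw [pow_succ]; push_cast; linarith
  have hn6 := hpow n hn
  have hn5 : (5 : ℝ) ≤ n := by exact_mod_cast hn
  have hsub : {ψ : PureState n | ¬ Typical ψ} ⊆
      ((⋃ x, {ψ | ψ.1 x = 0}) ∪ ⋃ x, {ψ | 12 * n / 2 ^ n ≤ ‖ψ.1 x‖ ^ 2}) ∪
      ⋃ x, ⋃ I : Finset (Fin n), {ψ | I.card = n / 8 + 1 ∧
        ∀ y ∈ I.image (flipBit x), ‖ψ.1 y‖ ^ 2 ≤ 1 / (2 ^ 43 * 2 ^ n)} := fun ψ hψ => by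
    by_contra hc
    simp only [Set.mem_union, Set.mem_iUnion, Set.mem_ofPred_eq, not_or, not_exists, not_and,
      not_le] at hc
    obtain ⟨⟨hc1, hc2⟩, hc3⟩ := hc
    refine hψ fun x => ⟨?_, (hc2 x).le, ?_⟩
    · exact pow_pos (norm_pos_iff.2 (hc1 x)) 2
    by_contra hlt
    rw [not_le, Finset.sum_boole] at hlt
    set G := Finset.univ.filter fun i => 1 / (2 ^ 43 * 2 ^ n) ≤ measDist ψ (flipBit x i) with hG
    have hGc : (G.card : ℝ) + (Gᶜ.card : ℝ) = n := by
      have := G.card_add_card_compl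
      rw [Fintype.card_fin] at this
      exact_mod_cast this
    -- More than `n / 8` bad directions contain a set of exactly `⌊n / 8⌋ + 1` of them, the size for
    -- which the union bound is set up.
    have hle : n / 8 + 1 ≤ Gᶜ.card := by
      have h1 : (n : ℝ) < 8 * (Gᶜ.card : ℝ) := by linarith
      have h2 : n < 8 * Gᶜ.card := by exact_mod_cast h1
      omega
    obtain ⟨I, hIG, hI⟩ := Finset.exists_subset_card_eq hle
    refine hc3 x I hI fun y hy => ?_
    obtain ⟨i, hi, rfl⟩ := Finset.mem_image.1 hy
    have := hIG hi
    simp only [hG, Finset.compl_filter, Finset.mem_filter, Finset.mem_univ, true_and,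
      not_le] at this
    exact this.le
  have hcube : (Finset.univ : Finset (Cube n)).card = 2 ^ n := by simp
  have hfin : (Finset.univ : Finset (Finset (Fin n))).card = 2 ^ n := by simp
  have hE : ∀ r : ℝ, (2 ^ n : ℕ) * ENNReal.ofReal r = ENNReal.ofReal (2 ^ n * r) := fun r => by
    rw [ENNReal.ofReal_mul (by positivity), ← ENNReal.ofReal_natCast]; push_cast; rfl
  have hA : haarState n (⋃ x, {ψ | ψ.1 x = 0}) ≤ ENNReal.ofReal (2 ^ n * (16 ^ n)⁻¹) := by
    refine (measure_iUnion_fintype_le _ _).trans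
      ((Finset.sum_le_card_nsmul _ _ _ fun x _ => haarState_amplitude_eq_zero_le x).trans ?_)
    rw [hcube, nsmul_eq_mul, hE]
  have hB : haarState n (⋃ x, {ψ | 12 * n / 2 ^ n ≤ ‖ψ.1 x‖ ^ 2}) ≤
      ENNReal.ofReal (2 ^ n * (2 * (16 ^ n)⁻¹)) := by
    refine (measure_iUnion_fintype_le _ _).trans
      ((Finset.sum_le_card_nsmul _ _ _ fun x _ => haarState_amplitude_large_le hn6 x).trans ?_)
    rw [hcube, nsmul_eq_mul, hE]
  have hC : haarState n (⋃ x, ⋃ I : Finset (Fin n), {ψ | I.card = n / 8 + 1 ∧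
        ∀ y ∈ I.image (flipBit x), ‖ψ.1 y‖ ^ 2 ≤ 1 / (2 ^ 43 * 2 ^ n)}) ≤
      ENNReal.ofReal (2 ^ n * (2 ^ n * (32 ^ n)⁻¹)) := by
    refine (measure_iUnion_fintype_le _ _).trans
      ((Finset.sum_le_card_nsmul _ _ (ENNReal.ofReal (2 ^ n * (32 ^ n)⁻¹)) fun x _ => ?_).trans ?_)
    · refine (measure_iUnion_fintype_le _ _).trans
        ((Finset.sum_le_card_nsmul _ _ (ENNReal.ofReal (32 ^ n)⁻¹) fun I _ => ?_).trans ?_)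
      · by_cases hI : I.card = n / 8 + 1
        · simp only [hI, true_and]
          exact haarState_amplitudes_small_le (by linarith)
            ((Finset.card_image_of_injective _ (flipBit_injective x)).trans hI)
        · simp [hI]
      · rw [hfin, nsmul_eq_mul, hE]
    · rw [hcube, nsmul_eq_mul, hE]
  refine (measure_mono hsub).trans ((measure_union_le _ _).trans
    ((add_le_add ((measure_union_le _ _).trans (add_le_add hA hB)) hC).trans ?_))
  rw [← ENNReal.ofReal_add (by positivity) (by positivity),
    ← ENNReal.ofReal_add (by positivity) (by positivity)]
  apply ENNReal.ofReal_le_ofReal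
  have h16 : (16 : ℝ) ^ n = (2 ^ n) ^ 4 := by rw [← pow_mul, mul_comm, pow_mul]; norm_num
  have h32 : (32 : ℝ) ^ n = (2 ^ n) ^ 5 := by rw [← pow_mul, mul_comm, pow_mul]; norm_num
  rw [h16, h32]
  have hbig : (30 : ℝ) ≤ 2 ^ n := by linarith
  generalize (2 : ℝ) ^ n = N at *
  have hN : 0 < N := by linarith
  have : N * (N ^ 4)⁻¹ + N * (2 * (N ^ 4)⁻¹) + N * (N * (N ^ 5)⁻¹) = 4 / N ^ 2 * N⁻¹ := by
    field_simp; norm_num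
  rw [this]
  refine mul_le_of_le_one_left (by positivity) ?_
  rw [div_le_one (by positivity)]
  nlinarith

end ShadowOverlap

namespace ShadowOverlap

/-! ### Spectral gap of the random walk -/

section Walk

variable {n : ℕ} {w : Cube n → ℝ}

/-- The Dirichlet form of the random walk with weights `w`. -/
noncomputable def dirichletForm (w f : Cube n → ℝ) : ℝ :=
  1 / (2 * n) * ∑ x, ∑ i, w x * w (flipBit x i) / (w x + w (flipBit x i)) *
    (f x - f (flipBit x i)) ^ 2

/-- Summation by parts: the conductance is invariant under exchanging the ends of an edge, which is
reversibility of the walk. -/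
theorem sum_conductance_mul_sub_mul (f g : Cube n → ℝ) :
    ∑ x, ∑ i, w x * w (flipBit x i) / (w x + w (flipBit x i)) *
      (f x - f (flipBit x i)) * g x =
    1 / 2 * ∑ x, ∑ i, w x * w (flipBit x i) / (w x + w (flipBit x i)) *
      (f x - f (flipBit x i)) * (g x - g (flipBit x i)) := by
  have h := sum_sum_flipBit fun (i : Fin n) (x : Cube n) =>
    w x * w (flipBit x i) / (w x + w (flipBit x i)) * (f x - f (flipBit x i)) * g x
  simp only [flipBit_flipBit] at h
  have h2 : ∀ (x : Cube n) (i : Fin n), w x * w (flipBit x i) / (w x + w (flipBit x i)) *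
      (f x - f (flipBit x i)) * (g x - g (flipBit x i)) =
      w x * w (flipBit x i) / (w x + w (flipBit x i)) * (f x - f (flipBit x i)) * g x +
      w (flipBit x i) * w x / (w (flipBit x i) + w x) *
        (f (flipBit x i) - f x) * g (flipBit x i) := fun x i => by
    rw [mul_comm (w (flipBit x i)) (w x), add_comm (w (flipBit x i)) (w x)]
    ring
  simp only [h2, Finset.sum_add_distrib]
  rw [h]
  ring

theorem hammingDist_eq_one_iff (x y : Cube n) :
    hammingDist x y = 1 ↔ ∃ i, flipBit x i = y := by
  rw [hammingDist, Finset.card_eq_one]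
  refine exists_congr fun i => ⟨fun h => funext fun j => ?_, fun h => ?_⟩
  · have hj := Finset.ext_iff.1 h j
    simp only [Finset.mem_filter, Finset.mem_univ, true_and, Finset.mem_singleton] at hj
    rcases eq_or_ne j i with rfl | hne
    · have := hj.2 rfl
      simp only [flipBit, Function.update_self]
      revert this
      cases x j <;> cases y j <;> simp
    · simpa [flipBit, hne] using hj
  · subst h
    ext j
    simp only [Finset.mem_filter, Finset.mem_univ, true_and, Finset.mem_singleton]
    rcases eq_or_ne j i with rfl | hne <;> simp [flipBit, *]

theorem sum_ite_hammingDist_eq_one (x : Cube n) (h : Cube n → ℝ) :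
    (∑ y, if hammingDist x y = 1 then h y else 0) = ∑ i, h (flipBit x i) := by
  rw [← Finset.sum_filter, ← Finset.sum_image (f := h) (s := Finset.univ) (flipBit_injective x).injOn]
  congr 1
  ext y
  simp [hammingDist_eq_one_iff]

theorem transition_mulVec (hw : ∀ x, 0 < w x) (hn : 0 < n) (f : {x // 0 < w x} → ℝ)
    (x : Cube n) :
    (transition w).mulVec f ⟨x, hw x⟩ = f ⟨x, hw x⟩ -
      1 / n * ∑ i, w (flipBit x i) / (w x + w (flipBit x i)) *
        (f ⟨x, hw x⟩ - f ⟨flipBit x i, hw _⟩) := by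
  have hn' : (n : ℝ) ≠ 0 := Nat.cast_ne_zero.2 hn.ne'
  have h1 : (transition w).mulVec f ⟨x, hw x⟩ =
      ∑ y, transition w ⟨x, hw x⟩ ⟨y, hw y⟩ * f ⟨y, hw y⟩ :=
    Fintype.sum_equiv (Equiv.subtypeUnivEquiv hw) _ _ fun y => rfl
  have h2 : ∀ y, transition w ⟨x, hw x⟩ ⟨y, hw y⟩ * f ⟨y, hw y⟩ =
      (if hammingDist x y = 1 then 1 / n * (w y / (w x + w y)) * f ⟨y, hw y⟩ else 0) +
      (if y = x then (1 / n * ∑ i, w x / (w x + w (flipBit x i))) * f ⟨x, hw x⟩ else 0) :=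
    fun y => by
      simp only [transition, Subtype.mk.injEq]
      rw [sum_ite_hammingDist_eq_one x fun y => w x / (w x + w y)]
      rcases eq_or_ne y x with rfl | hne
      · simp
      · simp [hne, hne.symm]
  rw [h1, Finset.sum_congr rfl fun y _ => h2 y, Finset.sum_add_distrib,
    sum_ite_hammingDist_eq_one x fun y => 1 / n * (w y / (w x + w y)) * f ⟨y, hw y⟩,
    Finset.sum_ite_eq' Finset.univ x, if_pos (Finset.mem_univ x)]
  have h3 : f ⟨x, hw x⟩ = 1 / n * ∑ _i : Fin n, f ⟨x, hw x⟩ := by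
    simp only [Finset.sum_const, Finset.card_univ, Fintype.card_fin, nsmul_eq_mul]
    field_simp
  generalize hb : f ⟨x, hw x⟩ = b at *
  have h4 : ∀ S : ℝ, b - 1 / n * S = 1 / n * (∑ _i : Fin n, b) - 1 / n * S := fun S => by
    rw [← h3]
  rw [h4, mul_assoc, Finset.sum_mul, Finset.mul_sum, Finset.mul_sum, Finset.mul_sum,
    ← Finset.sum_add_distrib, ← Finset.sum_sub_distrib]
  refine Finset.sum_congr rfl fun i _ => ?_
  have := hw x
  have := hw (flipBit x i)
  field_simp
  ring

/-- Pairing the eigenvalue equation with `g` gives `(1 - l) ⟨g, g⟩ = E(g)`, and pairing it with `1`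
gives `(1 - l) ⟨g, 1⟩ = 0`. If `l = 1` the energy vanishes and `g` is constant; otherwise `g` has
mean zero and the Poincaré inequality applies. -/
theorem secondEigenvalue_transition_le (hn : 0 < n) (hw : ∀ x, 0 < w x) {K : ℝ} (hK : 1 ≤ K)
    (hP : ∀ f : Cube n → ℝ, ∃ m : ℝ, ∑ x, w x * (f x - m) ^ 2 ≤ K * dirichletForm w f) :
    secondEigenvalue (transition w) ≤ 1 - 1 / K := by
  have hn' : (0 : ℝ) < n := Nat.cast_pos.2 hn
  have hK0 : 0 < K := one_pos.trans_le hK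
  -- The bound must be nonnegative, as the real supremum of the empty set is `0`; this is where `1 ≤
  -- K` enters.
  refine Real.sSup_le ?_ (sub_nonneg.2 ((div_le_one hK0).2 hK))
  rintro l ⟨f, hf, hl⟩
  set g : Cube n → ℝ := fun x => f ⟨x, hw x⟩ with hg
  have heq : ∀ x, (1 - l) * (w x * g x) =
      1 / n * ∑ i, w x * w (flipBit x i) / (w x + w (flipBit x i)) *
        (g x - g (flipBit x i)) := fun x => by
    have h1 := congrFun hl ⟨x, hw x⟩
    rw [transition_mulVec hw hn, Pi.smul_apply, smul_eq_mul] at h1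
    have h2 : (1 - l) * g x = 1 / n * ∑ i, w (flipBit x i) / (w x + w (flipBit x i)) *
        (g x - g (flipBit x i)) := by
      simp only [hg]
      linarith
    rw [mul_left_comm, h2, mul_left_comm, Finset.mul_sum]
    congr 1
    exact Finset.sum_congr rfl fun i _ => by ring
  have hsum : ∀ h : Cube n → ℝ, (1 - l) * ∑ x, w x * g x * h x = 1 / (2 * n) *
      ∑ x, ∑ i, w x * w (flipBit x i) / (w x + w (flipBit x i)) *
        (g x - g (flipBit x i)) * (h x - h (flipBit x i)) := fun h => by
    have h1 := sum_conductance_mul_sub_mul (w := w) g h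
    rw [Finset.mul_sum]
    simp only [← mul_assoc (1 - l)]
    simp only [mul_assoc (1 - l), heq, mul_assoc (1 / (n : ℝ)), Finset.sum_mul, ← Finset.mul_sum]
    rw [h1]
    field_simp
  have hgg : (1 - l) * ∑ x, w x * g x ^ 2 = dirichletForm w g := by
    have := hsum g
    simp only [mul_assoc, ← sq] at this
    simpa only [dirichletForm, mul_assoc] using this
  have hg1 : (1 - l) * ∑ x, w x * g x = 0 := by
    simpa using hsum fun _ => 1
  have hpos : ∀ m, 0 < ∑ x, w x * (g x - m) ^ 2 := fun m => by
    have hnn : ∀ x ∈ Finset.univ, 0 ≤ w x * (g x - m) ^ 2 := fun x _ =>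
      mul_nonneg (hw x).le (sq_nonneg _)
    refine (Finset.sum_nonneg hnn).lt_of_ne fun h0 => hf ⟨m, fun x => ?_⟩
    have := (Finset.sum_eq_zero_iff_of_nonneg hnn).1 h0.symm x.1 (Finset.mem_univ _)
    have := (mul_eq_zero.1 this).resolve_left (hw x.1).ne'
    exact sub_eq_zero.1 (pow_eq_zero_iff two_ne_zero |>.1 this)
  obtain ⟨m, hm⟩ := hP g
  rcases eq_or_ne l 1 with rfl | hl1
  · rw [sub_self, zero_mul] at hgg
    rw [← hgg, mul_zero] at hm
    exact absurd hm (hpos m).not_ge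
  · have h0 := (mul_eq_zero.1 hg1).resolve_left (sub_ne_zero.2 hl1.symm)
    have hexp : ∑ x, w x * (g x - m) ^ 2 = ∑ x, w x * g x ^ 2 + m ^ 2 * ∑ x, w x := by
      have : ∀ x, w x * (g x - m) ^ 2 = w x * g x ^ 2 - 2 * m * (w x * g x) + m ^ 2 * w x :=
        fun x => by ring
      simp only [this, Finset.sum_add_distrib, Finset.sum_sub_distrib, ← Finset.mul_sum, h0]
      ring
    have hV : 0 < ∑ x, w x * g x ^ 2 := by simpa using hpos 0
    have hW : 0 ≤ m ^ 2 * ∑ x, w x :=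
      mul_nonneg (sq_nonneg _) (Finset.sum_nonneg fun x _ => (hw x).le)
    rw [hexp, ← hgg] at hm
    have h1 : 1 * ∑ x, w x * g x ^ 2 ≤ K * (1 - l) * ∑ x, w x * g x ^ 2 := by linarith
    have h2 := le_of_mul_le_mul_right h1 hV
    have h3 : 1 / K ≤ 1 - l := by rw [div_le_iff₀ hK0]; linarith
    linarith

theorem relaxationTime_le {ψ : PureState n} (hn : 0 < n) (hw : ∀ x, 0 < measDist ψ x) {K : ℝ}
    (hK : 1 ≤ K) (hP : ∀ f : Cube n → ℝ, ∃ m : ℝ,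
      ∑ x, measDist ψ x * (f x - m) ^ 2 ≤ K * dirichletForm (measDist ψ) f) :
    relaxationTime ψ ≤ ENNReal.ofReal K := by
  have hK0 : 0 < K := one_pos.trans_le hK
  have h := secondEigenvalue_transition_le hn hw hK hP
  have h1 : ENNReal.ofReal K = (ENNReal.ofReal (1 / K))⁻¹ := by
    rw [← ENNReal.ofReal_inv_of_pos (by positivity), one_div, inv_inv]
  rw [relaxationTime, h1, ENNReal.inv_le_inv]
  exact ENNReal.ofReal_le_ofReal (by linarith)

/-! ### Variance bounds -/

theorem variance_le_dirichletForm {K : ℝ} (h1 : ∑ x, w x = 1)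
    (hP : ∀ f : Cube n → ℝ, ∃ m : ℝ, ∑ x, w x * (f x - m) ^ 2 ≤ K * dirichletForm w f)
    (f : Cube n → ℝ) :
    ∑ x, w x * f x ^ 2 - (∑ x, w x * f x) ^ 2 ≤ K * dirichletForm w f := by
  obtain ⟨m, hm⟩ := hP f
  have : ∀ x, w x * (f x - m) ^ 2 = w x * f x ^ 2 - 2 * m * (w x * f x) + m ^ 2 * w x :=
    fun x => by ring
  simp only [this, Finset.sum_add_distrib, Finset.sum_sub_distrib, ← Finset.mul_sum, h1] at hm
  nlinarith [sq_nonneg (∑ x, w x * f x - m)]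

/-- The walk is an average of conditional expectations onto pairs `{x, flipBit x i}`, hence positive
semidefinite. On one edge, with weights `a, b` and centred values `s, t`, the slack is `(a s + b t)²
/ (a + b)`. -/
theorem dirichletForm_le_variance (hn : 0 < n) (hw : ∀ x, 0 < w x) (h1 : ∑ x, w x = 1)
    (f : Cube n → ℝ) :
    dirichletForm w f ≤ ∑ x, w x * f x ^ 2 - (∑ x, w x * f x) ^ 2 := by
  have hn' : (0 : ℝ) < n := Nat.cast_pos.2 hn
  set μ := ∑ x, w x * f x with hμ
  have hvar : ∑ x, w x * (f x - μ) ^ 2 = ∑ x, w x * f x ^ 2 - μ ^ 2 := by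
    have : ∀ x, w x * (f x - μ) ^ 2 = w x * f x ^ 2 - 2 * μ * (w x * f x) + μ ^ 2 * w x :=
      fun x => by ring
    simp only [this, Finset.sum_add_distrib, Finset.sum_sub_distrib, ← Finset.mul_sum, h1, ← hμ]
    ring
  have key : ∀ x i, w x * w (flipBit x i) / (w x + w (flipBit x i)) *
      (f x - f (flipBit x i)) ^ 2 ≤
      w x * (f x - μ) ^ 2 + w (flipBit x i) * (f (flipBit x i) - μ) ^ 2 := fun x i => by
    have ha := hw x
    have hb := hw (flipBit x i)
    rw [div_mul_eq_mul_div, div_le_iff₀ (by positivity)]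
    nlinarith [sq_nonneg (w x * (f x - μ) + w (flipBit x i) * (f (flipBit x i) - μ))]
  have hsum : ∑ x, ∑ i, w x * w (flipBit x i) / (w x + w (flipBit x i)) *
      (f x - f (flipBit x i)) ^ 2 ≤ 2 * n * ∑ x, w x * (f x - μ) ^ 2 := by
    refine (Finset.sum_le_sum fun x _ => Finset.sum_le_sum fun i _ => key x i).trans (le_of_eq ?_)
    simp only [Finset.sum_add_distrib]
    rw [sum_sum_flipBit fun _ x => w x * (f x - μ) ^ 2]
    simp only [Finset.sum_const, Finset.card_univ, Fintype.card_fin, nsmul_eq_mul,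
      ← Finset.mul_sum]
    ring
  rw [← hvar, dirichletForm]
  calc _ ≤ 1 / (2 * n) * (2 * n * ∑ x, w x * (f x - μ) ^ 2) := by gcongr
    _ = _ := by field_simp

end Walk

/-! ### A Chernoff bound for product distributions on a finite set -/

section Chernoff

variable {α : Type*} [Fintype α] {p Y : α → ℝ}

open Classical in
-- Exponential Markov inequality with the Poisson bound `1 + q (exp s - 1) ≤ exp (q (exp s - 1))`.
-- The sign of `s` is free, so both tails are covered.
theorem sum_prod_tail_le (hp : ∀ a, 0 ≤ p a) (hp1 : ∑ a, p a = 1) (hY : ∀ a, Y a = 0 ∨ Y a = 1)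
    {T : ℕ} (s c : ℝ) (E : (Fin T → α) → Prop) (hE : ∀ o, E o → c ≤ s * ∑ t, Y (o t)) :
    (∑ o : Fin T → α, if E o then ∏ t, p (o t) else 0) ≤
      Real.exp (T * ((∑ a, p a * Y a) * (Real.exp s - 1)) - c) := by
  have hmgf : ∑ a, p a * Real.exp (s * Y a) = (∑ a, p a * Y a) * (Real.exp s - 1) + 1 := by
    conv_rhs => rw [Finset.sum_mul]; arg 2; rw [← hp1]
    rw [← Finset.sum_add_distrib]
    refine Finset.sum_congr rfl fun a _ => ?_
    rcases hY a with h | h <;> rw [h] <;> simp; ring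
  have hmgf0 : 0 ≤ ∑ a, p a * Real.exp (s * Y a) :=
    Finset.sum_nonneg fun a _ => mul_nonneg (hp a) (Real.exp_pos _).le
  calc (∑ o : Fin T → α, if E o then ∏ t, p (o t) else 0)
      ≤ ∑ o : Fin T → α, Real.exp (-c) * ∏ t, (p (o t) * Real.exp (s * Y (o t))) := by
        refine Finset.sum_le_sum fun o _ => ?_
        have h0 : 0 ≤ ∏ t, p (o t) := Finset.prod_nonneg fun t _ => hp _
        rw [Finset.prod_mul_distrib, ← Real.exp_sum, ← Finset.mul_sum, mul_left_comm,
          ← Real.exp_add]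
        split_ifs with h
        · refine le_mul_of_one_le_right h0 (Real.one_le_exp ?_)
          linarith [hE o h]
        · exact mul_nonneg h0 (Real.exp_pos _).le
    _ = Real.exp (-c) * (∑ a, p a * Real.exp (s * Y a)) ^ T := by
        rw [← Finset.mul_sum, Fintype.sum_pow]
    _ ≤ Real.exp (-c) * Real.exp ((∑ a, p a * Y a) * (Real.exp s - 1)) ^ T := by
        rw [hmgf] at hmgf0 ⊢
        gcongr
        exact Real.add_one_le_exp _
    _ = _ := by
        rw [← Real.exp_nat_mul, ← Real.exp_add]
        ring_nf

end Chernoff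

end ShadowOverlap

namespace ShadowOverlap

/-! ### Outcome statistics of a round -/

section Round

variable {n : ℕ}

theorem sum_mul_outcomeVec (Ψ : Cube n → ℂ) (b : Cube n → ℂ) (k : Fin n) (x : Cube n) :
    ∑ y, b y * outcomeVec Ψ k x y =
      b (Function.update x k false) * qubitBasis Ψ k x (x k) false +
      b (Function.update x k true) * qubitBasis Ψ k x (x k) true := by
  have hval : ∀ a, outcomeVec Ψ k x (Function.update x k a) = qubitBasis Ψ k x (x k) a := fun a => by
    rw [outcomeVec, Finset.prod_eq_single k]
    · simp
    · intro i _ hi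
      simp [hi]
    · simp
  have hne : Function.update x k false ≠ Function.update x k true := fun h => by
    simpa using congrFun h k
  rw [Fintype.sum_eq_add _ _ hne, hval, hval]
  rintro y ⟨hy0, hy1⟩
  obtain ⟨i, hik, hi⟩ : ∃ i, i ≠ k ∧ y i ≠ x i := by
    by_contra hc
    push Not at hc
    have hy : y = Function.update x k (y k) := by
      ext i
      rcases eq_or_ne i k with rfl | hik
      · simp
      · simp [hik, hc i hik]
    cases hk : y k
    · exact hy0 (by rw [hy, hk])
    · exact hy1 (by rw [hy, hk])
  rw [outcomeVec, Finset.prod_eq_zero (Finset.mem_univ i), mul_zero]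
  simp [hik, hi]

open scoped MatrixOrder in
-- Reduces a mixed state to the rows of `B`, which act as unnormalized bras; this is why amplitudes
-- are later divided by `star (Ψ x)`.
theorem exists_eq_conjTranspose_mul_self {ρ : Matrix (Cube n) (Cube n) ℂ} (hρ : ρ.PosSemidef) :
    ∃ B : Matrix (Cube n) (Cube n) ℂ, ρ = B.conjTranspose * B :=
  CStarAlgebra.nonneg_iff_eq_star_mul_self.1 hρ.nonneg

theorem expectation_conjTranspose_mul_self (B : Matrix (Cube n) (Cube n) ℂ) (v : Cube n → ℂ) :
    expectation (B.conjTranspose * B) v = ∑ j, ‖∑ y, B j y * v y‖ ^ 2 := by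
  rw [expectation, ← Matrix.mulVec_mulVec, Matrix.dotProduct_mulVec, ← Matrix.star_mulVec,
    dotProduct, Complex.re_sum]
  refine Finset.sum_congr rfl fun j _ => ?_
  rw [Pi.star_apply, Complex.star_def, ← Complex.normSq_eq_conj_mul_self, Complex.ofReal_re,
    Complex.normSq_eq_norm_sq]
  rfl

theorem re_trace_conjTranspose_mul_self (B : Matrix (Cube n) (Cube n) ℂ) :
    (B.conjTranspose * B).trace.re = ∑ j, ∑ y, ‖B j y‖ ^ 2 := by
  rw [Finset.sum_comm, Matrix.trace, Complex.re_sum]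
  refine Finset.sum_congr rfl fun y _ => ?_
  rw [Matrix.diag_apply, Matrix.mul_apply, Complex.re_sum]
  refine Finset.sum_congr rfl fun j _ => ?_
  rw [Matrix.conjTranspose_apply, Complex.star_def, ← Complex.normSq_eq_conj_mul_self,
    Complex.ofReal_re, Complex.normSq_eq_norm_sq]

/-- The (unnormalized) amplitude of the outcome `x` when qubit `k` is tested. -/
noncomputable def outcomeAmp (Ψ b : Cube n → ℂ) (k : Fin n) (x : Cube n) : ℂ :=
  ∑ y, b y * outcomeVec Ψ k x y

variable {Ψ : Cube n → ℂ}

theorem update_eq_self_or_flipBit (x : Cube n) (k : Fin n) (h : x k = false) :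
    Function.update x k false = x ∧ Function.update x k true = flipBit x k := by
  constructor
  · rw [← h, Function.update_eq_self]
  · rw [flipBit, h, Bool.not_false]

theorem update_flipBit (x : Cube n) (k : Fin n) (a : Bool) :
    Function.update (flipBit x k) k a = Function.update x k a := by
  simp [flipBit]

theorem not_degenerate (hΨ : ∀ x, Ψ x ≠ 0) (k : Fin n) (x : Cube n) : ¬ Degenerate Ψ k x :=
  fun h => hΨ _ h.1

theorem outcomeAmp_false (hΨ : ∀ x, Ψ x ≠ 0) (b : Cube n → ℂ) {k : Fin n} {x : Cube n}
    (hx : x k = false) :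
    outcomeAmp Ψ b k x = (b (flipBit x k) * star (Ψ x) - b x * star (Ψ (flipBit x k))) /
      (Real.sqrt (‖Ψ x‖ ^ 2 + ‖Ψ (flipBit x k)‖ ^ 2) : ℂ) := by
  obtain ⟨h0, h1⟩ := update_eq_self_or_flipBit x k hx
  rw [outcomeAmp, sum_mul_outcomeVec, hx]
  simp only [qubitBasis, not_degenerate hΨ k x, if_false, queryNorm, queryAmp, h0, h1]
  ring

theorem outcomeAmp_true (hΨ : ∀ x, Ψ x ≠ 0) (b : Cube n → ℂ) {k : Fin n} {x : Cube n}
    (hx : x k = false) :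
    outcomeAmp Ψ b k (flipBit x k) = (b x * Ψ x + b (flipBit x k) * Ψ (flipBit x k)) /
      (Real.sqrt (‖Ψ x‖ ^ 2 + ‖Ψ (flipBit x k)‖ ^ 2) : ℂ) := by
  obtain ⟨h0, h1⟩ := update_eq_self_or_flipBit x k hx
  have hf : flipBit x k k = true := by simp [flipBit, hx]
  rw [outcomeAmp, sum_mul_outcomeVec, hf]
  simp only [qubitBasis, not_degenerate hΨ k _, if_false, queryNorm, queryAmp, update_flipBit,
    h0, h1]
  ring

theorem norm_sq_div_sqrt (z : ℂ) {r : ℝ} (hr : 0 ≤ r) :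
    ‖z / (Real.sqrt r : ℂ)‖ ^ 2 = ‖z‖ ^ 2 / r := by
  rw [norm_div, div_pow, Complex.norm_real, Real.norm_eq_abs, sq_abs, Real.sq_sqrt hr]

/-- Parseval on the pair `{x, flipBit x k}`: both records share the outcomes `z`, and the basis of
qubit `k` is orthonormal. -/
theorem norm_sq_outcomeAmp_add (hΨ : ∀ x, Ψ x ≠ 0) (b : Cube n → ℂ) (k : Fin n) (x : Cube n) :
    ‖outcomeAmp Ψ b k x‖ ^ 2 + ‖outcomeAmp Ψ b k (flipBit x k)‖ ^ 2 =
      ‖b x‖ ^ 2 + ‖b (flipBit x k)‖ ^ 2 := by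
  have key : ∀ x : Cube n, x k = false →
      ‖outcomeAmp Ψ b k x‖ ^ 2 + ‖outcomeAmp Ψ b k (flipBit x k)‖ ^ 2 =
      ‖b x‖ ^ 2 + ‖b (flipBit x k)‖ ^ 2 := fun x hx => by
    have hp : 0 < ‖Ψ x‖ ^ 2 + ‖Ψ (flipBit x k)‖ ^ 2 := by
      have := norm_pos_iff.2 (hΨ x)
      positivity
    rw [outcomeAmp_false hΨ b hx, outcomeAmp_true hΨ b hx, norm_sq_div_sqrt _ hp.le,
      norm_sq_div_sqrt _ hp.le, ← add_div, div_eq_iff hp.ne']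
    simp only [Complex.sq_norm, Complex.normSq_apply, Complex.sub_re, Complex.sub_im,
      Complex.add_re, Complex.add_im, Complex.mul_re, Complex.mul_im, Complex.star_def,
      Complex.conj_re, Complex.conj_im]
    ring
  cases hx : x k
  · exact key x hx
  · have h := key (flipBit x k) (by simp [flipBit, hx])
    rw [flipBit_flipBit] at h
    linarith

theorem sum_norm_sq_outcomeAmp (hΨ : ∀ x, Ψ x ≠ 0) (b : Cube n → ℂ) (k : Fin n) :
    ∑ x, ‖outcomeAmp Ψ b k x‖ ^ 2 = ∑ x, ‖b x‖ ^ 2 := by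
  have h := Finset.sum_congr (rfl : Finset.univ = Finset.univ) fun x _ =>
    norm_sq_outcomeAmp_add hΨ b k x
  rw [Finset.sum_add_distrib, Finset.sum_add_distrib,
    sum_flipBit k fun x => ‖outcomeAmp Ψ b k x‖ ^ 2, sum_flipBit k fun x => ‖b x‖ ^ 2] at h
  linarith

/-- The conjugate-relative amplitude of `b` with respect to `Ψ`. -/
noncomputable def relAmp (Ψ b : Cube n → ℂ) (x : Cube n) : ℂ := b x / star (Ψ x)

theorem norm_sq_outcomeAmp_false (hΨ : ∀ x, Ψ x ≠ 0) (b : Cube n → ℂ) {k : Fin n} {x : Cube n}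
    (hx : x k = false) :
    ‖outcomeAmp Ψ b k x‖ ^ 2 =
      ‖Ψ x‖ ^ 2 * ‖Ψ (flipBit x k)‖ ^ 2 / (‖Ψ x‖ ^ 2 + ‖Ψ (flipBit x k)‖ ^ 2) *
        ‖relAmp Ψ b x - relAmp Ψ b (flipBit x k)‖ ^ 2 := by
  have h1 : star (Ψ x) ≠ 0 := star_ne_zero.2 (hΨ x)
  have h2 : star (Ψ (flipBit x k)) ≠ 0 := star_ne_zero.2 (hΨ _)
  have h3 : b (flipBit x k) * star (Ψ x) - b x * star (Ψ (flipBit x k)) =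
      -(star (Ψ x) * star (Ψ (flipBit x k)) *
        (relAmp Ψ b x - relAmp Ψ b (flipBit x k))) := by
    simp only [relAmp]
    field_simp
    ring
  rw [outcomeAmp_false hΨ b hx, norm_sq_div_sqrt _ (by positivity), h3, norm_neg, norm_mul,
    norm_mul, norm_star, norm_star]
  ring

/-- The identity behind the protocol: rejection measures the energy of the relative amplitude.
Records with `x k = false` meet each edge once and the Dirichlet form counts it twice, whence the
factor `1 / 2`. -/
theorem sum_norm_sq_outcomeAmp_false (hΨ : ∀ x, Ψ x ≠ 0) (b : Cube n → ℂ) :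
    1 / n * ∑ k, ∑ x, (if x k = false then ‖outcomeAmp Ψ b k x‖ ^ 2 else 0) =
      dirichletForm (fun x => ‖Ψ x‖ ^ 2) (fun x => (relAmp Ψ b x).re) +
      dirichletForm (fun x => ‖Ψ x‖ ^ 2) (fun x => (relAmp Ψ b x).im) := by
  set g : Fin n → Cube n → ℝ := fun k x =>
    ‖Ψ x‖ ^ 2 * ‖Ψ (flipBit x k)‖ ^ 2 / (‖Ψ x‖ ^ 2 + ‖Ψ (flipBit x k)‖ ^ 2) *
        ‖relAmp Ψ b x - relAmp Ψ b (flipBit x k)‖ ^ 2 with hg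
  have hgs : ∀ k x, g k (flipBit x k) = g k x := fun k x => by
    simp only [hg, flipBit_flipBit]
    rw [norm_sub_rev, mul_comm (‖Ψ (flipBit x k)‖ ^ 2), add_comm (‖Ψ (flipBit x k)‖ ^ 2)]
  have hk : ∀ k, ∑ x, (if x k = false then ‖outcomeAmp Ψ b k x‖ ^ 2 else 0) =
      1 / 2 * ∑ x, g k x := fun k => by
    have h1 : ∀ x : Cube n, (if x k = false then ‖outcomeAmp Ψ b k x‖ ^ 2 else 0) =
        if x k = false then g k x else 0 := fun x => by
      split_ifs with hx
      · exact norm_sq_outcomeAmp_false hΨ b hx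
      · rfl
    have h2 := sum_flipBit k fun x : Cube n => if x k = false then g k x else 0
    have h3 : ∀ x : Cube n, (if flipBit x k k = false then g k (flipBit x k) else 0) =
        g k x - if x k = false then g k x else 0 := fun x => by
      rw [hgs]
      have : flipBit x k k = !x k := by simp [flipBit]
      rw [this]
      cases x k <;> simp
    simp only [h3, Finset.sum_sub_distrib] at h2
    rw [Finset.sum_congr rfl fun x _ => h1 x]
    linarith
  simp only [hk, dirichletForm, ← mul_add, ← Finset.sum_add_distrib, ← Finset.mul_sum]
  rw [Finset.sum_comm, ← mul_assoc]
  congr 1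
  · ring
  refine Finset.sum_congr rfl fun x _ => Finset.sum_congr rfl fun i _ => ?_
  simp only [hg]
  rw [Complex.sq_norm (relAmp Ψ b x - _), Complex.normSq_apply, Complex.sub_re, Complex.sub_im]
  ring

theorem norm_sq_eq_mul_relAmp (hΨ : ∀ x, Ψ x ≠ 0) (b : Cube n → ℂ) (x : Cube n) :
    ‖b x‖ ^ 2 = ‖Ψ x‖ ^ 2 * (relAmp Ψ b x).re ^ 2 + ‖Ψ x‖ ^ 2 * (relAmp Ψ b x).im ^ 2 := by
  have h : b x = star (Ψ x) * relAmp Ψ b x := (mul_div_cancel₀ _ (star_ne_zero.2 (hΨ x))).symm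
  conv_lhs => rw [h, norm_mul, norm_star, mul_pow, Complex.sq_norm (relAmp Ψ b x),
    Complex.normSq_apply]
  ring

theorem norm_sq_sum_mul (hΨ : ∀ x, Ψ x ≠ 0) (b : Cube n → ℂ) :
    ‖∑ x, b x * Ψ x‖ ^ 2 = (∑ x, ‖Ψ x‖ ^ 2 * (relAmp Ψ b x).re) ^ 2 +
      (∑ x, ‖Ψ x‖ ^ 2 * (relAmp Ψ b x).im) ^ 2 := by
  have h : ∀ x, b x * Ψ x = ((‖Ψ x‖ ^ 2 : ℝ) : ℂ) * relAmp Ψ b x := fun x => by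
    have h1 : b x = star (Ψ x) * relAmp Ψ b x :=
      (mul_div_cancel₀ _ (star_ne_zero.2 (hΨ x))).symm
    conv_lhs => rw [h1, mul_right_comm, Complex.star_def, ← Complex.normSq_eq_conj_mul_self,
      Complex.normSq_eq_norm_sq]
  rw [Complex.sq_norm, Complex.normSq_apply, Complex.re_sum, Complex.im_sum]
  simp only [h, Complex.re_ofReal_mul, Complex.im_ofReal_mul]
  ring

variable {ρ : Matrix (Cube n) (Cube n) ℂ}

theorem roundProb_nonneg (hρ : IsDensityMatrix ρ) (o : Fin n × Cube n) :
    0 ≤ roundProb Ψ ρ o := by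
  obtain ⟨B, rfl⟩ := exists_eq_conjTranspose_mul_self hρ.1
  rw [roundProb, expectation_conjTranspose_mul_self]
  positivity

theorem sum_roundProb (hn : 0 < n) (hΨ : ∀ x, Ψ x ≠ 0) (hρ : IsDensityMatrix ρ) :
    ∑ o, roundProb Ψ ρ o = 1 := by
  have hn' : (n : ℝ) ≠ 0 := Nat.cast_ne_zero.2 hn.ne'
  obtain ⟨B, rfl⟩ := exists_eq_conjTranspose_mul_self hρ.1
  have htr := re_trace_conjTranspose_mul_self B
  rw [hρ.2, Complex.one_re] at htr
  have hk : ∀ k, ∑ x, ∑ j, ‖∑ y, B j y * outcomeVec Ψ k x y‖ ^ 2 = 1 := fun k => by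
    rw [Finset.sum_comm, htr]
    exact Finset.sum_congr rfl fun j _ => sum_norm_sq_outcomeAmp hΨ (B j) k
  simp only [roundProb, expectation_conjTranspose_mul_self, Fintype.sum_prod_type,
    ← Finset.mul_sum, hk]
  simp [hn']

/-- The probability that the local overlap reported in a round is `0`. -/
noncomputable def roundError (Ψ : Cube n → ℂ) (ρ : Matrix (Cube n) (Cube n) ℂ) : ℝ :=
  ∑ o, roundProb Ψ ρ o * (1 - localOverlap Ψ o)

/-- Row by row, the rejection probability is an energy and the infidelity a variance, so the two
comparisons of these quantities give the two bounds. -/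
theorem roundError_bounds (hn : 0 < n) {ψ : PureState n} (hψ : ∀ x, 0 < measDist ψ x) {K : ℝ}
    (hK : 0 < K) (hP : ∀ f : Cube n → ℝ, ∃ m : ℝ,
      ∑ x, measDist ψ x * (f x - m) ^ 2 ≤ K * dirichletForm (measDist ψ) f)
    (hρ : IsDensityMatrix ρ) :
    (1 - fidelity ψ ρ) / K ≤ roundError (fun x => ψ.1 x) ρ ∧
      roundError (fun x => ψ.1 x) ρ ≤ 1 - fidelity ψ ρ := by
  obtain ⟨B, rfl⟩ := exists_eq_conjTranspose_mul_self hρ.1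
  have htr := re_trace_conjTranspose_mul_self B
  rw [hρ.2, Complex.one_re] at htr
  set Ψ : Cube n → ℂ := fun x => ψ.1 x with hΨdef
  have hΨ : ∀ x, Ψ x ≠ 0 := fun x h => by
    have := hψ x
    simp only [measDist] at this
    simp only [hΨdef] at h
    simp [h] at this
  set D : (Cube n → ℝ) → ℝ := dirichletForm (measDist ψ) with hD
  have hw1 : ∑ x, measDist ψ x = 1 := sum_measDist ψ
  have herr : roundError Ψ (B.conjTranspose * B) =
      ∑ j, (D (fun x => (relAmp Ψ (B j) x).re) + D (fun x => (relAmp Ψ (B j) x).im)) := by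
    have h1 : ∀ k x, roundProb Ψ (B.conjTranspose * B) (k, x) * (1 - localOverlap Ψ (k, x)) =
        ∑ j, 1 / n * (if x k = false then ‖outcomeAmp Ψ (B j) k x‖ ^ 2 else 0) := fun k x => by
      simp only [roundProb, expectation_conjTranspose_mul_self, localOverlap,
        not_degenerate hΨ k x, if_false, outcomeAmp, ← Finset.mul_sum]
      rcases Bool.eq_false_or_eq_true (x k) with hx | hx <;> simp [hx]
    rw [roundError, Fintype.sum_prod_type]
    simp only [h1]
    rw [Finset.sum_congr rfl fun k _ => Finset.sum_comm, Finset.sum_comm]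
    refine Finset.sum_congr rfl fun j _ => ?_
    rw [hD]
    refine Eq.trans ?_ (sum_norm_sq_outcomeAmp_false hΨ (B j))
    simp only [Finset.mul_sum]
  have hfid : 1 - fidelity ψ (B.conjTranspose * B) =
      ∑ j, ((∑ x, measDist ψ x * (relAmp Ψ (B j) x).re ^ 2 -
        (∑ x, measDist ψ x * (relAmp Ψ (B j) x).re) ^ 2) +
        (∑ x, measDist ψ x * (relAmp Ψ (B j) x).im ^ 2 -
        (∑ x, measDist ψ x * (relAmp Ψ (B j) x).im) ^ 2)) := by
    rw [fidelity, expectation_conjTranspose_mul_self]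
    refine (congrArg (· - _) htr).trans ?_
    rw [← Finset.sum_sub_distrib]
    refine Finset.sum_congr rfl fun j _ => ?_
    rw [norm_sq_sum_mul hΨ, Finset.sum_congr rfl fun x _ => norm_sq_eq_mul_relAmp hΨ (B j) x,
      Finset.sum_add_distrib]
    simp only [measDist, hΨdef]
    ring
  rw [herr, hfid]
  constructor
  · rw [div_le_iff₀' hK, Finset.mul_sum]
    refine Finset.sum_le_sum fun j _ => ?_
    rw [mul_add]
    exact add_le_add (variance_le_dirichletForm hw1 hP _) (variance_le_dirichletForm hw1 hP _)
  · refine Finset.sum_le_sum fun j _ => ?_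
    exact add_le_add (dirichletForm_le_variance hn hψ hw1 _)
      (dirichletForm_le_variance hn hψ hw1 _)

end Round

/-! ### Correctness of the protocol -/

theorem outputProb_add {n : ℕ} {Ψ : Cube n → ℂ} {ρ : Matrix (Cube n) (Cube n) ℂ}
    (h1 : ∑ o, roundProb Ψ ρ o = 1) (ε τ : ℝ) (T : ℕ) :
    outputProb Ψ ρ ε τ T Verdict.certified + outputProb Ψ ρ ε τ T Verdict.failed = 1 := by
  rw [outputProb, outputProb, ← Finset.sum_add_distrib]
  calc _ = ∑ o : Fin T → Fin n × Cube n, ∏ t, roundProb Ψ ρ (o t) := by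
        refine Finset.sum_congr rfl fun o _ => ?_
        cases verdict Ψ ε τ o <;> simp
    _ = 1 := by rw [← Fintype.sum_pow, h1, one_pow]

theorem certifiesTarget_of_poincare {n : ℕ} (hn : 0 < n) {ψ : PureState n}
    (hψ : ∀ x, 0 < measDist ψ x) {K : ℝ} (hK : 0 < K)
    (hP : ∀ f : Cube n → ℝ, ∃ m : ℝ,
      ∑ x, measDist ψ x * (f x - m) ^ 2 ≤ K * dirichletForm (measDist ψ) f)
    {ε δ : ℝ} (hε : 0 < ε) (hδ : 0 < δ) (hδ1 : δ < 1) {T : ℕ}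
    (hT : 32 * K / ε * Real.log (1 / δ) ≤ T) : CertifiesTarget ψ ε K δ T := by
  intro ρ hρ
  set Ψ : Cube n → ℂ := fun x => ψ.1 x with hΨdef
  have hΨ : ∀ x, Ψ x ≠ 0 := fun x h => by
    have := hψ x
    simp only [measDist] at this
    simp only [hΨdef] at h
    simp [h] at this
  obtain ⟨hlow, hupp⟩ := roundError_bounds hn hψ hK hP hρ
  have hp0 := fun o => roundProb_nonneg (Ψ := Ψ) hρ o
  have hp1 := sum_roundProb hn hΨ hρ
  have hY : ∀ o, 1 - localOverlap Ψ o = 0 ∨ 1 - localOverlap Ψ o = 1 := fun o => by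
    simp only [localOverlap]
    split_ifs <;> simp
  set q := roundError Ψ ρ with hq
  set a := ε / K with ha
  have ha0 : 0 < a := div_pos hε hK
  have hlog : 0 < Real.log (1 / δ) := Real.log_pos (by rw [lt_div_iff₀ hδ]; linarith)
  have hTa : Real.log (1 / δ) ≤ T * a / 32 := by
    have h1 : 32 * K / ε * Real.log (1 / δ) * (a / 32) = Real.log (1 / δ) := by
      rw [ha]; field_simp
    calc _ = 32 * K / ε * Real.log (1 / δ) * (a / 32) := h1.symm
      _ ≤ T * (a / 32) := by gcongr
      _ = _ := by ring
  have hT0 : (0 : ℝ) < T := lt_of_lt_of_le (by positivity) hT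
  have hexpδ : ∀ r, r ≤ -(T * a / 32) → Real.exp r ≤ δ := fun r hr => by
    rw [← Real.exp_log hδ]
    refine Real.exp_le_exp.2 ?_
    rw [one_div, Real.log_inv] at hTa
    linarith
  have hsumY : ∀ o : Fin T → Fin n × Cube n, ∑ t, (1 - localOverlap Ψ (o t)) =
      T - ∑ t, localOverlap Ψ (o t) := fun o => by simp
  have hcert : ∀ o : Fin T → Fin n × Cube n, verdict Ψ ε K o = Verdict.certified ↔
      ∑ t, (1 - localOverlap Ψ (o t)) ≤ 3 * a / 4 * T := fun o => by
    have h2 : 3 * ε / (4 * K) = 3 * a / 4 := by rw [ha]; field_simp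
    rw [hsumY, verdict, h2]
    split_ifs with h <;> rw [le_div_iff₀ hT0] at h
    · simp only [true_iff]; linarith
    · simp only [false_iff]; linarith
  have hfail : ∀ o : Fin T → Fin n × Cube n, verdict Ψ ε K o = Verdict.failed →
      3 * a / 4 * T ≤ ∑ t, (1 - localOverlap Ψ (o t)) := fun o ho => by
    by_contra hc
    rw [(hcert o).2 (not_le.1 hc).le] at ho
    cases ho
  have hadd := outputProb_add hp1 ε K T
  constructor
  · intro hF
    have hqa : a ≤ q := le_trans (by rw [ha]; gcongr; linarith) hlow
    -- With `q ≥ a` and threshold `3 a / 4`, the exponent is at most `T a (-7/32 + 6/32) = -T a /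
    -- 32`.
    have hb := sum_prod_tail_le hp0 hp1 hY (-1 / 4) (-1 / 4 * (3 * a / 4 * T))
      (fun o : Fin T → Fin n × Cube n => verdict Ψ ε K o = Verdict.certified)
      fun o ho => by linarith [(hcert o).1 ho]
    have he : Real.exp (-1 / 4) - 1 ≤ -7 / 32 := by
      have h3 := Real.quadratic_le_exp_of_nonneg (x := 1 / 4) (by norm_num)
      have h4 : Real.exp (-1 / 4) * Real.exp (1 / 4) = 1 := by
        rw [← Real.exp_add]; norm_num
      have h5 : 0 < Real.exp (-1 / 4) := Real.exp_pos _
      nlinarith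
    have h6 : outputProb Ψ ρ ε K T Verdict.certified ≤ δ := by
      refine hb.trans (hexpδ _ ?_)
      rw [← roundError, ← hq]
      have h7 : q * (Real.exp (-1 / 4) - 1) ≤ a * (-7 / 32) := by nlinarith
      nlinarith
    linarith
  · intro hF
    have hqa : q ≤ a / 2 := by
      have : ε / (2 * K) = a / 2 := by rw [ha]; field_simp
      linarith
    -- With `q ≤ a / 2`, the exponent is at most `T a (5/32 - 6/32) = -T a / 32`, the same rate as
    -- in the other case.
    have hb := sum_prod_tail_le hp0 hp1 hY (1 / 4) (1 / 4 * (3 * a / 4 * T))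
      (fun o : Fin T → Fin n × Cube n => verdict Ψ ε K o = Verdict.failed)
      fun o ho => by linarith [hfail o ho]
    have he : Real.exp (1 / 4) - 1 ≤ 5 / 16 := by
      have := (abs_le.1 (Real.abs_exp_sub_one_sub_id_le (x := 1 / 4) (by norm_num [abs_le]))).2
      linarith
    have he0 : 0 ≤ Real.exp (1 / 4) - 1 := by linarith [Real.add_one_le_exp (1 / 4 : ℝ)]
    have h6 : outputProb Ψ ρ ε K T Verdict.failed ≤ δ := by
      refine hb.trans (hexpδ _ ?_)
      rw [← roundError, ← hq]
      have h7 : q * (Real.exp (1 / 4) - 1) ≤ a / 2 * (5 / 16) := by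
        calc _ ≤ a / 2 * (Real.exp (1 / 4) - 1) := by gcongr
          _ ≤ _ := by gcongr
      nlinarith
    linarith

theorem Typical.poincare {n : ℕ} (hn : 0 < n) {ψ : PureState n} (h : Typical ψ)
    (f : Cube n → ℝ) : ∃ m : ℝ, ∑ x, measDist ψ x * (f x - m) ^ 2 ≤
      96000 * 2 ^ 43 * (n : ℝ) ^ 2 * dirichletForm (measDist ψ) f := by
  have hn' : (0 : ℝ) < n := Nat.cast_pos.2 hn
  obtain ⟨m, hm⟩ := exists_weighted_poincare hn (by positivity) (fun x => (h x).1)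
    (fun x => (h x).2.1) (fun x => (h x).2.2) f
  refine ⟨m, hm.trans (le_of_eq ?_)⟩
  -- Here `M / θ = 12 · 2⁴³ n`, and the factor `1 / (2 n)` in the Dirichlet form contributes `2 n`:
  -- `4000 · 12 · 2 = 96000`.
  rw [dirichletForm, ← mul_assoc]
  congr 1
  field_simp
  norm_num

end ShadowOverlap

theorem mainTheorem2 :
    ∃ c A B : ℝ, 0 < c ∧ 0 < A ∧ 0 < B ∧ ∃ n₀ : ℕ, ∀ n : ℕ, n₀ ≤ n →
      ShadowOverlap.haarState n
        {ψ : ShadowOverlap.PureState n |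
          ¬ (ShadowOverlap.relaxationTime ψ ≤ ENNReal.ofReal (A * (n : ℝ) ^ 2) ∧
            ∀ ε δ : ℝ, 0 < ε → 0 < δ → δ < 1 →
              ∀ T : ℕ, B * (n : ℝ) ^ 2 / ε * Real.log (1 / δ) ≤ (T : ℝ) →
                ShadowOverlap.CertifiesTarget ψ ε (A * (n : ℝ) ^ 2) δ T)}
        ≤ ENNReal.ofReal ((2 : ℝ) ^ (-(c * (n : ℝ)))) := by
  -- `A` is the Poincaré constant divided by `n²`, `B = 32 A` comes from the Chernoff rate, and `5`
  -- is the threshold that ensures `6 n ≤ 2 ^ n`.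
  refine ⟨1, 96000 * 2 ^ 43, 32 * (96000 * 2 ^ 43), one_pos, by norm_num, by norm_num, 5,
    fun n hn => ?_⟩
  have hn0 : 0 < n := by omega
  have hn1 : (1 : ℝ) ≤ n := Nat.one_le_cast.2 hn0
  have hK : (1 : ℝ) ≤ 96000 * 2 ^ 43 * (n : ℝ) ^ 2 := by nlinarith
  refine (MeasureTheory.measure_mono ?_).trans
    ((ShadowOverlap.haarState_not_typical_le hn).trans (le_of_eq ?_))
  · refine fun ψ hψ hty => hψ ?_
    have hP := ShadowOverlap.Typical.poincare hn0 hty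
    refine ⟨ShadowOverlap.relaxationTime_le hn0 (fun x => (hty x).1) hK hP,
      fun ε δ hε hδ hδ1 T hT => ShadowOverlap.certifiesTarget_of_poincare hn0
        (fun x => (hty x).1) (one_pos.trans_le hK) hP hε hδ hδ1 ?_⟩
    rwa [← mul_assoc]
  · rw [one_mul, Real.rpow_neg zero_le_two, Real.rpow_natCast]
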